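/- **Setting.** Let $\mathscr S$ be a set of locally compact (Hausdorff) abelian groups such that for any $X,Y\in\mathscr S$ there is $Z\in\mathscr S$ of which $X$ and $Y$ are compatible subgroups, i.e. closed subgroups carrying the topology of $Z$ and such that the map $X\oplus Y\to X+Y$, $(x,y)\mapsto x+y$, is open ($X+Y$ with the topology of $Z$). A many-body system is a subset $\mathcal S\subset\mathscr S$ such that $X\cap Y\in\mathcal S$ for all $X,Y\in\mathcal S$ and such that $X/Y$ is not compact whenever $X\supsetneq Y$ are in $\mathcal S$, together with a (regular) Haar measure on each $X\in\mathcal S$. (Example: the finite-dimensional subspaces of a real prehilbert space with their Euclidean measures, $\mathcal S$ being any set of them that is stable under intersections.) Let $\mathcal H=\bigoplus_{X\in\mathcal S}L^2(X)$ be the Hilbert direct sum, and regard $\mathscr L_{XY}=L(L^2(Y),L^2(X))$ as a subspace of $L(\mathcal H)$ by $T\mapsto\Pi_X^*T\,\Pi_Y$, where $\Pi_X:\mathcal H\to L^2(X)$ is the canonical projection. For subspaces $\mathscr R_{XY}\subset\mathscr L_{XY}$ write $(\mathscr R_{XY})_{X,Y\in\mathcal S}$ for the closed linear span of all the $\mathscr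 R_{XY}$ in $L(\mathcal H)$, and put $\mathscr L=(\mathscr L_{XY})_{X,Y\in\mathcal S}$. For spaces $\mathscr A,\mathscr B$ of operators, $\mathscr A\cdot\mathscr B$ is the closed linear span of the products $AB$ with $A\in\mathscr A$, $B\in\mathscr B$. For $X,Y\in\mathcal S$ and $\varphi\in C_c(X+Y)$ let $(T_{XY}(\varphi)f)(x)=\int_Y\varphi(x-y)f(y)\,dy$ for $f\in L^2(Y)$, and let $\mathscr T_{XY}\subset\mathscr L_{XY}$ be the norm closure of the set of the operators $T_{XY}(\varphi)$. Let $\mathscr T=(\mathscr T_{XY})_{X,Y\in\mathcal S}$, and let $\mathscr T^\circ$ be the closed linear span of those $\mathscr T_{XY}$ for which $X\subset Y$ or $Y\subset X$. For $Y\subset X$ let $\mathcal C_X(Y)$ be the set of operators on $L^2(X)$ of multiplication by $\varphi\circ\pi_Y$, $\varphi\in C_0(X/Y)$, where $\pi_Y:X\to X/Y$ is the canonical surjection; let $\mathcal C_X$ be the closed linear span of the $\mathcal C_X(Y)$ with $Y\in\mathcal S$, $Y\subset X$; and let $\mathcal C_{\rm diag}=\bigoplus_{X\in\mathcal S}\mathcal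 C_X$ be the closed linear span of the diagonal blocks $\mathcal C_X\subset\mathscr L_{XX}\subset L(\mathcal H)$. Finally let $\mathscr C_{XY}=\mathscr T_{XY}\cdot\mathcal C_Y$ and $\mathscr C=(\mathscr C_{XY})_{X,Y\in\mathcal S}$. **Theorem.** For every many-body system $\mathcal S$ as above: 1. each $\varphi\in C_c(X+Y)$ defines a bounded operator $T_{XY}(\varphi):L^2(Y)\to L^2(X)$, and $\mathscr T$ is a closed self-adjoint linear subspace of $\mathscr L$; 2. $\mathscr T\cdot\mathscr T$ is a $C^*$-algebra of operators on $\mathcal H$ (a norm-closed $*$-subalgebra of $L(\mathcal H)$), and it is non-degenerate: the vectors $Au$ with $A\in\mathscr T\cdot\mathscr T$, $u\in\mathcal H$, span a dense subspace of $\mathcal H$; 3. $\mathscr C_{XY}=\mathcal C_X\cdot\mathscr T_{XY}$ for all $X,Y\in\mathcal S$, and $$\mathscr C=\mathscr T\cdot\mathscr T=\mathscr T\cdot\mathcal C_{\rm diag}=\mathcal C_{\rm diag}\cdot\mathscr T=\mathscr T^\circ\cdot\mathscr T^\circ .$$ -/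

import Mathlib

open MeasureTheory Topology
open scoped ENNReal ZeroAtInfty

noncomputable section

namespace ManyBody

universe u

/-- `X` and `Y` are compatible subgroups of the topological abelian group `G`: both are closed and
the addition map `X ⊕ Y → X + Y` is open, where `X`, `Y` and `X + Y` carry the topologies
induced by `G`. -/
def CompatibleSubgroups {G : Type u} [AddCommGroup G] [TopologicalSpace G]
    (X Y : AddSubgroup G) : Prop :=
  IsClosed (X : Set G) ∧ IsClosed (Y : Set G) ∧
    IsOpenMap (fun p : X × Y =>
      (⟨(p.1 : G) + (p.2 : G), AddSubgroup.add_mem_sup p.1.2 p.2.2⟩ : ↥(X ⊔ Y)))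

/-- A set of locally compact (Hausdorff) abelian groups such that any two members `X`, `Y` are
compatible subgroups of some member `Z`. Such a set is directed by inclusion, so that all its
members are subgroups of one abelian group `E`, their union. Each member has its own topology;
there is no topology on `E`. -/
structure LCAFamily (E : Type u) [AddCommGroup E] where
  /-- the members of the family -/
  groups : Set (AddSubgroup E)
  /-- the topology of a member -/
  top : ∀ X : groups, TopologicalSpace ↥(X : AddSubgroup E)
  isTopologicalAddGroup : ∀ X : groups, @IsTopologicalAddGroup _ (top X) _
  locallyCompactSpace : ∀ X : groups, @LocallyCompactSpace _ (top X)
  t2Space : ∀ X : groups, @T2Space _ (top X)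
  exists_compatible : ∀ X Y : groups, ∃ Z : groups,
    ∃ hX : (X : AddSubgroup E) ≤ (Z : AddSubgroup E),
    ∃ hY : (Y : AddSubgroup E) ≤ (Z : AddSubgroup E),
      top X = (top Z).induced (AddSubgroup.inclusion hX) ∧
      top Y = (top Z).induced (AddSubgroup.inclusion hY) ∧
      @CompatibleSubgroups _ _ (top Z)
        ((X : AddSubgroup E).addSubgroupOf Z) ((Y : AddSubgroup E).addSubgroupOf Z)

variable {E : Type u} [AddCommGroup E] {𝓕 : LCAFamily E}

instance (X : 𝓕.groups) : TopologicalSpace ↥(X : AddSubgroup E) := 𝓕.top X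
instance (X : 𝓕.groups) : IsTopologicalAddGroup ↥(X : AddSubgroup E) := 𝓕.isTopologicalAddGroup X
instance (X : 𝓕.groups) : LocallyCompactSpace ↥(X : AddSubgroup E) := 𝓕.locallyCompactSpace X
instance (X : 𝓕.groups) : T2Space ↥(X : AddSubgroup E) := 𝓕.t2Space X
instance (X : 𝓕.groups) : MeasurableSpace ↥(X : AddSubgroup E) := borel _
instance (X : 𝓕.groups) : BorelSpace ↥(X : AddSubgroup E) := ⟨rfl⟩

/-- A many-body system: a subset `S` of the family, stable under intersections and such that
`X / Y` is not compact if `Y ⊊ X` are in `S`, together with a (regular) Haar measure on each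
`X ∈ S`. -/
structure ManyBodySystem (𝓕 : LCAFamily E) where
  /-- the configuration spaces of the system -/
  S : Set 𝓕.groups
  inf_mem : ∀ X ∈ S, ∀ Y ∈ S, ∃ Z ∈ S,
    (Z : AddSubgroup E) = (X : AddSubgroup E) ⊓ (Y : AddSubgroup E)
  not_compact : ∀ X ∈ S, ∀ Y ∈ S, (Y : AddSubgroup E) < (X : AddSubgroup E) →
    ¬ CompactSpace (↥(X : AddSubgroup E) ⧸ (Y : AddSubgroup E).addSubgroupOf (X : AddSubgroup E))
  /-- the chosen Haar measures -/
  haar : ∀ X : S, Measure ↥((X : 𝓕.groups) : AddSubgroup E)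
  isAddHaarMeasure : ∀ X : S, (haar X).IsAddHaarMeasure
  regular : ∀ X : S, (haar X).Regular

/-- `𝓐 · 𝓑`: the closed linear span of the products `A B` with `A ∈ 𝓐` and `B ∈ 𝓑`. -/
def clMul {H₁ H₂ H₃ : Type u} [NormedAddCommGroup H₁] [NormedSpace ℂ H₁]
    [NormedAddCommGroup H₂] [NormedSpace ℂ H₂] [NormedAddCommGroup H₃] [NormedSpace ℂ H₃]
    (𝓐 : Submodule ℂ (H₂ →L[ℂ] H₃)) (𝓑 : Submodule ℂ (H₁ →L[ℂ] H₂)) :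
    Submodule ℂ (H₁ →L[ℂ] H₃) :=
  (Submodule.span ℂ {T | ∃ A ∈ 𝓐, ∃ B ∈ 𝓑, T = A ∘L B}).topologicalClosure

infixl:70 " ⬝ᶜ " => clMul

/-- The map `X ⊕ Y → X + Y`, `(x, y) ↦ x - y`. -/
def diffMap (X Y : 𝓕.groups) (p : ↥(X : AddSubgroup E) × ↥(Y : AddSubgroup E)) :
    ↥((X : AddSubgroup E) ⊔ (Y : AddSubgroup E)) :=
  ⟨(p.1 : E) - (p.2 : E),
    sub_mem (AddSubgroup.mem_sup_left p.1.2) (AddSubgroup.mem_sup_right p.2.2)⟩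

/-- The topology of `X + Y`, as the quotient of `X ⊕ Y` by the kernel `{(z, z) | z ∈ X ∩ Y}`
of `(x, y) ↦ x - y`. As `X` and `Y` are compatible, this is also the topology which `X + Y`
inherits from any member of the family that contains `X` and `Y`. -/
abbrev sumTopology (X Y : 𝓕.groups) :
    TopologicalSpace ↥((X : AddSubgroup E) ⊔ (Y : AddSubgroup E)) :=
  TopologicalSpace.coinduced (diffMap X Y) inferInstance

/-- `φ ∈ C_c(X + Y)`. -/
def IsCc (X Y : 𝓕.groups) (φ : ↥((X : AddSubgroup E) ⊔ (Y : AddSubgroup E)) → ℂ) : Prop :=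
  @Continuous _ _ (sumTopology X Y) _ φ ∧ @HasCompactSupport _ _ (sumTopology X Y) _ φ

namespace ManyBodySystem

variable (𝓢 : ManyBodySystem 𝓕)

/-- `L²(X)` -/
abbrev HX (X : 𝓢.S) : Type u := Lp ℂ 2 (𝓢.haar X)

/-- The Hilbert direct sum of the spaces `L²(X)`, `X ∈ S`. -/
abbrev H : Type u := lp (fun X : 𝓢.S => 𝓢.HX X) 2

/-- The canonical projection of `⊕_X L²(X)` onto its component `L²(X)`; its adjoint is the
canonical embedding. -/
def proj (X : 𝓢.S) : 𝓢.H →L[ℂ] 𝓢.HX X := lp.evalCLM ℂ (fun X : 𝓢.S => 𝓢.HX X) 2 X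

/-- An operator `T : L²(Y) → L²(X)` as an operator on `⊕_X L²(X)`. -/
def embed {X Y : 𝓢.S} (T : 𝓢.HX Y →L[ℂ] 𝓢.HX X) : 𝓢.H →L[ℂ] 𝓢.H :=
  ContinuousLinearMap.adjoint (𝓢.proj X) ∘L T ∘L 𝓢.proj Y

/-- `(R_{XY})_{X,Y ∈ S}`: the closed linear span of the blocks `R_{XY}` in the bounded operators
on `⊕_X L²(X)`. -/
def blockSpace (R : ∀ X Y : 𝓢.S, Submodule ℂ (𝓢.HX Y →L[ℂ] 𝓢.HX X)) :
    Submodule ℂ (𝓢.H →L[ℂ] 𝓢.H) :=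
  (Submodule.span ℂ {A | ∃ X Y, ∃ T ∈ R X Y, A = 𝓢.embed T}).topologicalClosure

/-- `⊕_{X ∈ S} R_X`: the closed linear span of the diagonal blocks `R_X`. -/
def diagSpace (R : ∀ X : 𝓢.S, Submodule ℂ (𝓢.HX X →L[ℂ] 𝓢.HX X)) :
    Submodule ℂ (𝓢.H →L[ℂ] 𝓢.H) :=
  (Submodule.span ℂ {A | ∃ X, ∃ T ∈ R X, A = 𝓢.embed T}).topologicalClosure

/-- The closed linear span of all the spaces `L(L²(Y), L²(X))` with `X, Y ∈ S`. -/
def bigL : Submodule ℂ (𝓢.H →L[ℂ] 𝓢.H) := 𝓢.blockSpace fun _ _ => ⊤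

/-- `T = T_{XY}(φ)`, that is, `(T f)(x) = ∫_Y φ(x - y) f(y) dy`. -/
def IsConv (X Y : 𝓢.S) (φ : ↥((X : AddSubgroup E) ⊔ (Y : AddSubgroup E)) → ℂ)
    (T : 𝓢.HX Y →L[ℂ] 𝓢.HX X) : Prop :=
  ∀ f : 𝓢.HX Y, T f =ᵐ[𝓢.haar X]
    fun x => ∫ y, φ (diffMap (X : 𝓕.groups) (Y : 𝓕.groups) (x, y)) * f y ∂(𝓢.haar Y)

/-- `𝒯_{XY}`: the norm closure of the operators `T_{XY}(φ)` with `φ ∈ C_c(X + Y)`. (They form a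
linear space, so that taking the span adds nothing.) -/
def TXY (X Y : 𝓢.S) : Submodule ℂ (𝓢.HX Y →L[ℂ] 𝓢.HX X) :=
  (Submodule.span ℂ {T | ∃ φ, IsCc (X : 𝓕.groups) (Y : 𝓕.groups) φ ∧
    𝓢.IsConv X Y φ T}).topologicalClosure

/-- `𝒞_X(Y)` for `Y ⊆ X`: the operators on `L²(X)` of multiplication by `φ ∘ π_Y`, where
`φ ∈ C₀(X / Y)` and `π_Y : X → X / Y` is the canonical surjection. -/
def mulOps (X Y : 𝓢.S) : Set (𝓢.HX X →L[ℂ] 𝓢.HX X) :=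
  {M | ∃ φ : C₀(↥((X : 𝓕.groups) : AddSubgroup E) ⧸
        ((Y : 𝓕.groups) : AddSubgroup E).addSubgroupOf ((X : 𝓕.groups) : AddSubgroup E), ℂ),
      ∀ f : 𝓢.HX X, M f =ᵐ[𝓢.haar X] fun x => φ (QuotientAddGroup.mk x) * f x}

/-- `𝒞_X`: the closed linear span of the `𝒞_X(Y)` with `Y ∈ S`, `Y ⊆ X`. -/
def CX (X : 𝓢.S) : Submodule ℂ (𝓢.HX X →L[ℂ] 𝓢.HX X) :=
  (Submodule.span ℂ {M | ∃ Y : 𝓢.S, ((Y : 𝓕.groups) : AddSubgroup E) ≤ (X : 𝓕.groups) ∧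
    M ∈ 𝓢.mulOps X Y}).topologicalClosure

/-- `𝒯 = (𝒯_{XY})_{X,Y ∈ S}` -/
def T : Submodule ℂ (𝓢.H →L[ℂ] 𝓢.H) := 𝓢.blockSpace 𝓢.TXY

open Classical in
/-- `𝒯°`: only the blocks `𝒯_{XY}` with `X ⊆ Y` or `Y ⊆ X` are kept. -/
def Tcirc : Submodule ℂ (𝓢.H →L[ℂ] 𝓢.H) :=
  𝓢.blockSpace fun X Y =>
    if ((X : 𝓕.groups) : AddSubgroup E) ≤ (Y : 𝓕.groups) ∨
        ((Y : 𝓕.groups) : AddSubgroup E) ≤ (X : 𝓕.groups)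
    then 𝓢.TXY X Y else ⊥

/-- The diagonal algebra `⊕_X 𝒞_X`. -/
def Cdiag : Submodule ℂ (𝓢.H →L[ℂ] 𝓢.H) := 𝓢.diagSpace 𝓢.CX

/-- `𝒞_{XY} = 𝒯_{XY} · 𝒞_Y` -/
def CXY (X Y : 𝓢.S) : Submodule ℂ (𝓢.HX Y →L[ℂ] 𝓢.HX X) := 𝓢.TXY X Y ⬝ᶜ 𝓢.CX Y

/-- The Hamiltonian algebra `𝒞 = (𝒞_{XY})_{X,Y ∈ S}`. -/
def C : Submodule ℂ (𝓢.H →L[ℂ] 𝓢.H) := 𝓢.blockSpace 𝓢.CXY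

end ManyBodySystem

end ManyBody

end

set_option linter.unusedSectionVars false

noncomputable section

namespace ManyBody

universe u

open Filter
open scoped Pointwise

/-! Everything rests on one identity, `TXY_clMul_TXY` and its adjoint `TXY_clMul_TXY'`: 𝒯_XZ · 𝒯_ZY
= 𝒯_XY · 𝒞_Y(Y ∩ Z) = 𝒞_X(X ∩ Z) · 𝒯_XY.

Work in a member G of the family that contains X, Y and Z. The product of the convolutions by Φ, Ψ ∈
C_c(G) has kernel ∫_Z Φ(x - z) Ψ(z - y) dz. As a function of y and s = x - y this is invariant under
translation of y by Y ∩ Z, so it lives on (Y / (Y ∩ Z)) × G, and compatibility makes its support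
compact there. A partition of unity on the quotient approximates it uniformly by sums of θᵢ(x - y)
χᵢ(π y), which are kernels from 𝒯_XY · 𝒞_Y(Y ∩ Z) (`convSpan_clMul_le`). Conversely, each u ∈ C_c(Y
/ (Y ∩ Z)) has the form ∫_Z H(y - z) dz with H ∈ C_c(G) (`exists_integral_sub_eq`). In Θ(x - y) H(y
- z) a partition of unity in the variable y - z allows x - y to be replaced by x - z - aᵢ, which
leaves a sum of products of convolutions (`convSpan_clMul_mulSpan_le`). In both directions the error
kernel is uniformly small and lives where x - y is in a fixed compact set, so Schur's test
(`IsKernel.norm_le`) makes it small in operator norm.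

The second ingredient is 𝒞_V(W) · 𝒞_V(W') ⊆ 𝒞_V(W ∩ W') (`mulSpan_clMul_mulSpan_le`), which again
depends on compatibility.

The rest is algebra of closed spans. For W ⊆ Y the identity reads 𝒯_XY · 𝒞_Y(W) = 𝒯_XW · 𝒯_WY, so
𝒞_XY is the closed span of the 𝒯_XZ · 𝒯_ZY over all Z. The same holds for 𝒞_X · 𝒯_XY, whence the
factorizations of 𝒞. The intermediate Z may be replaced by X ∩ Y ∩ Z, which gives 𝒯° · 𝒯°. A product
of four factors collapses to one with values in 𝒞_XY (`TXY_clMul_four_le`), so 𝒯 · 𝒯 is an algebra.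
It is non-degenerate because convolutions on X have no common kernel. -/

/-- `T` is the integral operator with kernel `k`. -/
def IsKernel {X Y : Type*} [MeasurableSpace X] [MeasurableSpace Y] (μ : Measure X) (ν : Measure Y)
    (k : X → Y → ℂ) (T : Lp ℂ 2 ν →L[ℂ] Lp ℂ 2 μ) : Prop :=
  ∀ f : Lp ℂ 2 ν, T f =ᵐ[μ] fun x => ∫ y, k x y * f y ∂ν

/-! ### L² inequalities and density of C_c in L². -/

theorem sq_integral_mul_le {α : Type*} [MeasurableSpace α] {μ : Measure α} {f g : α → ℝ}
    (hf : Integrable (fun x => f x ^ 2) μ) (hg : Integrable (fun x => g x ^ 2) μ)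
    (hfg : Integrable (fun x => f x * g x) μ) :
    (∫ x, f x * g x ∂μ) ^ 2 ≤ (∫ x, f x ^ 2 ∂μ) * ∫ x, g x ^ 2 ∂μ := by
  have key : ∀ t : ℝ, 0 ≤ (∫ x, f x ^ 2 ∂μ) * (t * t) + (2 * ∫ x, f x * g x ∂μ) * t
      + ∫ x, g x ^ 2 ∂μ := by
    intro t
    have h : ∫ x, (t * f x + g x) ^ 2 ∂μ = (∫ x, f x ^ 2 ∂μ) * (t * t)
        + (2 * ∫ x, f x * g x ∂μ) * t + ∫ x, g x ^ 2 ∂μ := by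
      have e : (fun x => (t * f x + g x) ^ 2)
          = fun x => (t * t) * f x ^ 2 + (2 * t) * (f x * g x) + g x ^ 2 := by
        funext x; ring
      have h1 : Integrable (fun x => (t * t) * f x ^ 2) μ := hf.const_mul _
      have h2 : Integrable (fun x => (2 * t) * (f x * g x)) μ := hfg.const_mul _
      have h12 : Integrable (fun x => (t * t) * f x ^ 2 + (2 * t) * (f x * g x)) μ := h1.add h2
      rw [e, integral_add h12 hg, integral_add h1 h2, integral_const_mul, integral_const_mul]
      ring
    rw [← h]
    exact integral_nonneg fun x => sq_nonneg _
  have := discrim_le_zero key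
  unfold discrim at this
  nlinarith

theorem eLpNorm_two_eq {α : Type*} [MeasurableSpace α] {μ : Measure α} {f : α → ℂ}
    (hf : MemLp f 2 μ) : eLpNorm f 2 μ = ENNReal.ofReal (√(∫ x, ‖f x‖ ^ 2 ∂μ)) := by
  rw [hf.eLpNorm_eq_integral_rpow_norm (by norm_num) (by norm_num), Real.sqrt_eq_rpow]
  simp

theorem integrable_mul_of_memLp_two {α : Type*} [MeasurableSpace α] {μ : Measure α} {f g : α → ℂ}
    (hf : MemLp f 2 μ) (hg : MemLp g 2 μ) : Integrable (fun x => f x * g x) μ :=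
  hf.integrable_mul hg

theorem enorm_integral_mul_le {α : Type*} [MeasurableSpace α] {μ : Measure α} {f g : α → ℂ}
    (hf : AEStronglyMeasurable f μ) (hg : AEStronglyMeasurable g μ) :
    ‖∫ x, f x * g x ∂μ‖ₑ ≤ eLpNorm f 2 μ * eLpNorm g 2 μ := by
  refine (enorm_integral_le_lintegral_enorm _).trans ?_
  rw [← eLpNorm_one_eq_lintegral_enorm]
  simpa using eLpNorm_le_eLpNorm_mul_eLpNorm_of_nnnorm (p := 2) (q := 2) (r := 1) hf hg
    (fun a b : ℂ => a * b) 1 (ae_of_all _ fun x => by simp)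

theorem isCompact_sub {G : Type*} [AddCommGroup G] [TopologicalSpace G] [IsTopologicalAddGroup G]
    {K L : Set G} (hK : IsCompact K) (hL : IsCompact L) : IsCompact (K - L) := by
  rw [sub_eq_add_neg]; exact hK.add hL.neg

/-- It suffices to treat the indicator of a set of finite measure. Shrinking it to a compact set
first, and only then enlarging to an open set, leaves room for a Urysohn function of compact
support. -/
theorem exists_hasCompactSupport_eLpNorm_sub_le {Y : Type*} [TopologicalSpace Y]
    [LocallyCompactSpace Y] [T2Space Y] [MeasurableSpace Y] [BorelSpace Y] {ν : Measure Y}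
    [ν.Regular] {f : Y → ℂ} (hf : MemLp f 2 ν) {ε : ℝ≥0∞} (hε : ε ≠ 0) :
    ∃ g : Y → ℂ, eLpNorm (f - g) 2 ν ≤ ε ∧ Continuous g ∧ MemLp g 2 ν ∧ HasCompactSupport g := by
  refine hf.induction_dense (by norm_num) _ ?_ ?_ ?_ hε
  · intro c t ht htν ε hε
    obtain ⟨δ, δpos, hδ⟩ := exists_Lp_half ℂ ν 2 hε
    obtain ⟨η, ηpos, hη⟩ := exists_eLpNorm_indicator_le (μ := ν) (p := 2) (by norm_num) c δpos.ne'
    have hη0 : (η : ℝ≥0∞) ≠ 0 := (ENNReal.coe_pos.2 ηpos).ne'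
    obtain ⟨s, st, s_compact, s_closed, hs⟩ := ht.exists_isCompact_isClosed_sdiff_lt htν.ne hη0
    have hsν : ν s ≠ ∞ := ((measure_mono st).trans_lt htν).ne
    obtain ⟨V, sV, V_open, -, hV⟩ := s_closed.measurableSet.exists_isOpen_sdiff_lt hsν hη0
    obtain ⟨g, g1, g0, g_supp, g_range⟩ := exists_continuous_one_zero_of_isCompact s_compact
      V_open.isClosed_compl (Set.disjoint_compl_right_iff_subset.2 sV)
    have gc : Continuous fun x => (g x : ℂ) * c := by fun_prop
    have gs : HasCompactSupport fun x => (g x : ℂ) * c := by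
      refine g_supp.mono fun x hx h => hx (by simp [h])
    have gm : MemLp (fun x => (g x : ℂ) * c) 2 ν := gc.memLp_of_hasCompactSupport gs
    have bd : ∀ x, ‖(g x : ℂ) * c - s.indicator (fun _ => c) x‖
        ≤ ‖(V \ s).indicator (fun _ => c) x‖ := by
      intro x
      by_cases hxs : x ∈ s
      · simp [g1 hxs, hxs]
      · by_cases hxV : x ∈ V
        · simp only [hxs, not_false_eq_true, Set.indicator_of_notMem, sub_zero, norm_mul,
            Complex.norm_real, Real.norm_eq_abs, abs_of_nonneg (g_range x).1]
          rw [Set.indicator_of_mem (show x ∈ V \ s from ⟨hxV, hxs⟩)]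
          exact mul_le_of_le_one_left (norm_nonneg c) (g_range x).2
        · simp [g0 hxV, hxs]
    have I1 : eLpNorm ((fun x => (g x : ℂ) * c) - s.indicator fun _ => c) 2 ν ≤ δ :=
      (eLpNorm_mono bd).trans (hη _ hV.le)
    have I2 : eLpNorm ((s.indicator fun _ => c) - t.indicator fun _ => c) 2 ν ≤ δ := by
      rw [← eLpNorm_neg, neg_sub, ← Set.indicator_sdiff st]
      exact hη _ hs.le
    have ms : AEStronglyMeasurable (s.indicator fun _ => c) ν :=
      aestronglyMeasurable_const.indicator s_closed.measurableSet
    have mt : AEStronglyMeasurable (t.indicator fun _ => c) ν :=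
      aestronglyMeasurable_const.indicator ht
    have := hδ _ _ (gm.aestronglyMeasurable.sub ms) (ms.sub mt) I1 I2
    rw [sub_add_sub_cancel] at this
    exact ⟨_, this.le, gc, gm, gs⟩
  · rintro f g ⟨f1, f2, f3⟩ ⟨g1, g2, g3⟩
    exact ⟨f1.add g1, f2.add g2, f3.add g3⟩
  · rintro f ⟨-, f2, -⟩
    exact f2.aestronglyMeasurable

theorem exists_seq_hasCompactSupport {Y : Type*} [TopologicalSpace Y] [LocallyCompactSpace Y]
    [T2Space Y] [MeasurableSpace Y] [BorelSpace Y] {ν : Measure Y} [ν.Regular] {f : Y → ℂ}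
    (hf : MemLp f 2 ν) :
    ∃ φ : ℕ → Y → ℂ, (∀ n, Continuous (φ n)) ∧ (∀ n, HasCompactSupport (φ n)) ∧
      (∀ n, MemLp (φ n) 2 ν) ∧ Tendsto (fun n => eLpNorm (f - φ n) 2 ν) atTop (𝓝 0) := by
  have h : ∀ n : ℕ, ((n : ℝ≥0∞) + 1)⁻¹ ≠ 0 := fun n => by simp
  choose φ h2 h3 h4 h1 using fun n : ℕ => exists_hasCompactSupport_eLpNorm_sub_le hf (h n)
  refine ⟨φ, h3, h1, h4, tendsto_of_tendsto_of_tendsto_of_le_of_le tendsto_const_nhds ?_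
    (fun n => zero_le) h2⟩
  have := (tendsto_add_atTop_iff_nat 1).2 ENNReal.tendsto_inv_nat_nhds_zero
  simpa using this

/-! ### Integral operators with kernel supported where x - y lies in a compact set; Schur's test. -/

section Kernels

variable {G X Y Z : Type*}
  [AddCommGroup G] [TopologicalSpace G] [IsTopologicalAddGroup G] [LocallyCompactSpace G]
  [T2Space G]
  [AddCommGroup X] [TopologicalSpace X] [IsTopologicalAddGroup X] [LocallyCompactSpace X]
  [T2Space X] [MeasurableSpace X] [BorelSpace X]
  [AddCommGroup Y] [TopologicalSpace Y] [IsTopologicalAddGroup Y] [LocallyCompactSpace Y]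
  [T2Space Y] [MeasurableSpace Y] [BorelSpace Y]
  [AddCommGroup Z] [TopologicalSpace Z] [IsTopologicalAddGroup Z] [LocallyCompactSpace Z]
  [T2Space Z] [MeasurableSpace Z] [BorelSpace Z]
  {iX : X →+ G} {iY : Y →+ G} {iZ : Z →+ G}
  {μ : Measure X} {ν : Measure Y} {ρ : Measure Z}

theorem integral_le_of_support_sub [ν.IsAddHaarMeasure] (hY : IsClosedEmbedding iY) {D : Set G}
    (hD : IsCompact D) {κ : Y → ℝ} {c : ℝ} (h0 : ∀ y, 0 ≤ κ y) (hc : ∀ y, κ y ≤ c)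
    (hκ : ∀ y y', κ y ≠ 0 → κ y' ≠ 0 → iY y - iY y' ∈ D) :
    ∫ y, κ y ∂ν ≤ c * ν.real (iY ⁻¹' D) := by
  have hc0 : 0 ≤ c := (h0 0).trans (hc 0)
  by_cases hz : ∀ y, κ y = 0
  · simp only [hz, integral_zero]; positivity
  push Not at hz
  obtain ⟨y₀, hy₀⟩ := hz
  -- One point y₀ of the support is enough: the whole support lies in the translate of the preimage
  -- of D by y₀, and translation does not change Haar measure.
  set S : Set Y := (fun y => y + -y₀) ⁻¹' (iY ⁻¹' D) with hS
  have hSm : MeasurableSet S :=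
    ((hD.isClosed.preimage hY.continuous).preimage (continuous_add_const _)).measurableSet
  have hνS : ν S = ν (iY ⁻¹' D) := measure_preimage_add_right _ _ _
  have hfin : ν S ≠ ∞ := by rw [hνS]; exact (hY.isCompact_preimage hD).measure_ne_top
  calc ∫ y, κ y ∂ν ≤ ∫ y, S.indicator (fun _ => c) y ∂ν := by
        refine integral_mono_of_nonneg (ae_of_all _ h0)
          ((integrable_indicator_iff hSm).2 (integrableOn_const hfin)) (ae_of_all _ fun y => ?_)
        by_cases hy : κ y = 0
        · rw [hy]; exact Set.indicator_nonneg (fun _ _ => hc0) _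
        · have : y ∈ S := by
            simpa [hS, ← sub_eq_add_neg] using hκ y y₀ hy hy₀
          rw [Set.indicator_of_mem this]; exact hc y
    _ = c * ν.real (iY ⁻¹' D) := by
        rw [integral_indicator hSm, setIntegral_const, smul_eq_mul, mul_comm, Measure.real,
          hνS, ← Measure.real]

theorem isCompact_preimage_sub (hY : IsClosedEmbedding iY) {L : Set G} (hL : IsCompact L) (g : G) :
    IsCompact {y | g - iY y ∈ L} :=
  (((Homeomorph.subLeft g).isClosedEmbedding.comp hY).isCompact_preimage hL :)

theorem hasCompactSupport_slice {E : Type*} [Zero E] (hY : IsClosedEmbedding iY) {L : Set G}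
    (hL : IsCompact L) {κ : Y → E} (g : G) (hκ : ∀ y, κ y ≠ 0 → g - iY y ∈ L) :
    HasCompactSupport κ :=
  HasCompactSupport.of_support_subset_isCompact (isCompact_preimage_sub hY hL g) fun y hy => hκ y hy

/-- The constant in the norm estimate for integral operators whose kernel lives on
`{(x, y) | x - y ∈ L}`. -/
def schurConst (iX : X →+ G) (iY : Y →+ G) (μ : Measure X) (ν : Measure Y) (L : Set G) : ℝ :=
  √(μ.real (iX ⁻¹' (L - L)) * ν.real (iY ⁻¹' (L - L)))

theorem continuous_hasCompactSupport_integral [IsFiniteMeasureOnCompacts ν]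
    (hX : IsClosedEmbedding iX) (hY : IsClosedEmbedding iY) {L : Set G} (hL : IsCompact L)
    {k : X → Y → ℂ} (hk : Continuous (Function.uncurry k))
    (hs : ∀ x y, k x y ≠ 0 → iX x - iY y ∈ L) {f : Y → ℂ} (hf : Continuous f)
    (hf' : HasCompactSupport f) :
    HasCompactSupport (Function.uncurry fun x y => k x y * f y) ∧
    Continuous (fun x => ∫ y, k x y * f y ∂ν) ∧
    HasCompactSupport (fun x => ∫ y, k x y * f y ∂ν) := by
  set K : Set X := iX ⁻¹' (L + iY '' tsupport f) with hK
  have hKc : IsCompact K :=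
    hX.isCompact_preimage (hL.add (hf'.isCompact.image hY.continuous))
  have hz : ∀ x y, k x y * f y ≠ 0 → x ∈ K ∧ y ∈ tsupport f := by
    intro x y h
    have h1 := hs x y (left_ne_zero_of_mul h)
    have h2 : y ∈ tsupport f := subset_tsupport _ (right_ne_zero_of_mul h)
    exact ⟨⟨_, h1, _, ⟨y, h2, rfl⟩, by simp⟩, h2⟩
  have hc : Continuous (Function.uncurry fun x y => k x y * f y) :=
    hk.mul (hf.comp continuous_snd)
  refine ⟨HasCompactSupport.of_support_subset_isCompact (hKc.prod hf'.isCompact)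
    fun p hp => hz p.1 p.2 hp, ?_, HasCompactSupport.of_support_subset_isCompact hKc ?_⟩
  · rw [← continuousOn_univ]
    exact continuousOn_integral_of_compact_support hf'.isCompact hc.continuousOn
      fun x y _ hy => by rw [image_eq_zero_of_notMem_tsupport hy, mul_zero]
  · intro x hx
    by_contra hxK
    apply hx
    have : ∀ y, k x y * f y = 0 := fun y => by
      by_contra h; exact hxK (hz x y h).1
    simp [this]

/-- Schur's test. It is first proved for f ∈ C_c, since the Haar measures need not be σ-finite and
Fubini is applied only to continuous integrands of compact support. -/
theorem integral_sq_norm_kernel_le [μ.IsAddHaarMeasure] [ν.IsAddHaarMeasure]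
    (hX : IsClosedEmbedding iX) (hY : IsClosedEmbedding iY) {L : Set G} (hL : IsCompact L)
    {k : X → Y → ℂ} (hk : Continuous (Function.uncurry k))
    (hs : ∀ x y, k x y ≠ 0 → iX x - iY y ∈ L) {c : ℝ} (hc : ∀ x y, ‖k x y‖ ≤ c)
    {f : Y → ℂ} (hf : Continuous f) (hf' : HasCompactSupport f) :
    ∫ x, ‖∫ y, k x y * f y ∂ν‖ ^ 2 ∂μ ≤
      (c * schurConst iX iY μ ν L) ^ 2 * ∫ y, ‖f y‖ ^ 2 ∂ν := by
  have hc0 : 0 ≤ c := (norm_nonneg _).trans (hc 0 0)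
  have hLL : IsCompact (L - L) := isCompact_sub hL hL
  have kx : ∀ x, Continuous (k x) := fun x => hk.comp (by fun_prop : Continuous fun y => (x, y))
  have ky : ∀ y, Continuous (fun x => k x y) :=
    fun y => hk.comp (by fun_prop : Continuous fun x => (x, y))
  have sx : ∀ x, HasCompactSupport (k x) := fun x => hasCompactSupport_slice hY hL (iX x) (hs x)
  set A := ν.real (iY ⁻¹' (L - L)) with hA
  set B := μ.real (iX ⁻¹' (L - L)) with hB
  have hAx : ∀ x, ∫ y, ‖k x y‖ ∂ν ≤ c * A := fun x =>
    integral_le_of_support_sub hY hLL (fun _ => norm_nonneg _) (hc x) fun y y' h h' =>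
      ⟨_, hs x y' (norm_ne_zero_iff.1 h'), _, hs x y (norm_ne_zero_iff.1 h), by simp⟩
  have hBy : ∀ y, ∫ x, ‖k x y‖ ∂μ ≤ c * B := fun y =>
    integral_le_of_support_sub hX hLL (fun _ => norm_nonneg _) (fun x => hc x y) fun x x' h h' =>
      ⟨_, hs x y (norm_ne_zero_iff.1 h), _, hs x' y (norm_ne_zero_iff.1 h'), by simp⟩
  obtain ⟨hcs, -, hgs⟩ := continuous_hasCompactSupport_integral (ν := ν) hX hY hL hk hs hf hf'
  have hFc : Continuous (Function.uncurry fun x y => ‖k x y‖ * ‖f y‖ ^ 2) :=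
    hk.norm.mul ((hf.comp continuous_snd).norm.pow 2)
  have hFs : HasCompactSupport (Function.uncurry fun x y => ‖k x y‖ * ‖f y‖ ^ 2) := by
    refine hcs.mono fun p hp => ?_
    simp only [Function.uncurry, Function.mem_support, ne_eq, mul_eq_zero, norm_eq_zero,
      pow_eq_zero_iff two_ne_zero, not_or] at hp ⊢
    exact hp
  have hslice : ∀ x, (∫ y, ‖k x y‖ * ‖f y‖ ∂ν) ^ 2 ≤
      (c * A) * ∫ y, ‖k x y‖ * ‖f y‖ ^ 2 ∂ν := by
    intro x
    -- Cauchy–Schwarz is applied to the factors √|k| and √|k| · |f|.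
    have e1 : ∀ y, √‖k x y‖ ^ 2 = ‖k x y‖ := fun y => Real.sq_sqrt (norm_nonneg _)
    have sc : Continuous fun y => √‖k x y‖ := (kx x).norm.sqrt
    have i1 : Integrable (fun y => √‖k x y‖ ^ 2) ν := by
      simp only [e1]
      exact (kx x).norm.integrable_of_hasCompactSupport (sx x).norm
    have i2 : Integrable (fun y => (√‖k x y‖ * ‖f y‖) ^ 2) ν := by
      refine ((sc.mul hf.norm).pow 2).integrable_of_hasCompactSupport (hf'.mono fun y hy => ?_)
      intro h; apply hy; simp [h]
    have i3 : Integrable (fun y => √‖k x y‖ * (√‖k x y‖ * ‖f y‖)) ν := by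
      refine (sc.mul (sc.mul hf.norm)).integrable_of_hasCompactSupport (hf'.mono fun y hy => ?_)
      intro h; apply hy; simp [h]
    have := sq_integral_mul_le i1 i2 i3
    simp only [mul_pow, e1, ← mul_assoc, Real.mul_self_sqrt (norm_nonneg _)] at this
    refine this.trans (mul_le_mul_of_nonneg_right (hAx x) (integral_nonneg fun y => by positivity))
  have hnorm : ∀ x, ‖∫ y, k x y * f y ∂ν‖ ^ 2 ≤ (c * A) * ∫ y, ‖k x y‖ * ‖f y‖ ^ 2 ∂ν := by
    intro x
    refine le_trans ?_ (hslice x)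
    gcongr
    refine (norm_integral_le_integral_norm _).trans (le_of_eq ?_)
    simp only [norm_mul]
  have hGc : Integrable (fun x => ∫ y, ‖k x y‖ * ‖f y‖ ^ 2 ∂ν) μ := by
    have h1 : Continuous fun x => ∫ y, ‖k x y‖ * ‖f y‖ ^ 2 ∂ν := by
      rw [← continuousOn_univ]
      exact continuousOn_integral_of_compact_support hf'.isCompact hFc.continuousOn
        fun x y _ hy => by simp [image_eq_zero_of_notMem_tsupport hy]
    refine h1.integrable_of_hasCompactSupport ?_
    refine HasCompactSupport.of_support_subset_isCompact (hFs.isCompact.image continuous_fst)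
      fun x hx => ?_
    by_contra hxK
    apply hx
    have : ∀ y, ‖k x y‖ * ‖f y‖ ^ 2 = 0 := fun y => by
      by_contra h
      exact hxK ⟨(x, y), subset_tsupport _ h, rfl⟩
    simp [this]
  have hA0 : 0 ≤ A := measureReal_nonneg
  have hB0 : 0 ≤ B := measureReal_nonneg
  calc ∫ x, ‖∫ y, k x y * f y ∂ν‖ ^ 2 ∂μ
      ≤ ∫ x, (c * A) * ∫ y, ‖k x y‖ * ‖f y‖ ^ 2 ∂ν ∂μ :=
        integral_mono_of_nonneg (ae_of_all _ fun x => by positivity) (hGc.const_mul _)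
          (ae_of_all _ hnorm)
    _ = (c * A) * ∫ y, ∫ x, ‖k x y‖ * ‖f y‖ ^ 2 ∂μ ∂ν := by
        rw [integral_const_mul, integral_integral_swap_of_hasCompactSupport hFc hFs]
    _ ≤ (c * A) * ∫ y, (c * B) * ‖f y‖ ^ 2 ∂ν := by
        gcongr ?_ * ?_
        refine integral_mono_of_nonneg (ae_of_all _ fun y => integral_nonneg fun x => by positivity)
          (((hf.norm.pow 2).integrable_of_hasCompactSupport (hf'.mono fun y hy h =>
            hy (by simp [h]))).const_mul _) (ae_of_all _ fun y => ?_)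
        simp only [integral_mul_const]
        gcongr
        exact hBy y
    _ = (c * schurConst iX iY μ ν L) ^ 2 * ∫ y, ‖f y‖ ^ 2 ∂ν := by
        rw [integral_const_mul, mul_pow, schurConst, Real.sq_sqrt (by positivity)]
        ring

/-- Extends Schur's test from C_c to L². Each slice of k is in L², so L² convergence of the
functions f gives convergence of the integrals at every x. This yields measurability, and Fatou's
lemma passes the norm bound to the limit. -/
theorem memLp_kernel [μ.IsAddHaarMeasure] [ν.IsAddHaarMeasure] [ν.Regular]
    (hX : IsClosedEmbedding iX) (hY : IsClosedEmbedding iY) {L : Set G} (hL : IsCompact L)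
    {k : X → Y → ℂ} (hk : Continuous (Function.uncurry k))
    (hs : ∀ x y, k x y ≠ 0 → iX x - iY y ∈ L) {c : ℝ} (hc : ∀ x y, ‖k x y‖ ≤ c)
    {f : Y → ℂ} (hf : MemLp f 2 ν) :
    MemLp (fun x => ∫ y, k x y * f y ∂ν) 2 μ ∧
    eLpNorm (fun x => ∫ y, k x y * f y ∂ν) 2 μ ≤
      ENNReal.ofReal (c * schurConst iX iY μ ν L) * eLpNorm f 2 ν := by
  have hc0 : 0 ≤ c := (norm_nonneg _).trans (hc 0 0)
  set N := c * schurConst iX iY μ ν L with hN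
  have hN0 : 0 ≤ N := mul_nonneg hc0 (Real.sqrt_nonneg _)
  have kx : ∀ x, Continuous (k x) := fun x => hk.comp (by fun_prop : Continuous fun y => (x, y))
  have kL : ∀ x, MemLp (k x) 2 ν := fun x =>
    (kx x).memLp_of_hasCompactSupport (hasCompactSupport_slice hY hL (iX x) (hs x))
  obtain ⟨φ, h1, h2, h3, h4⟩ := exists_seq_hasCompactSupport hf
  set g : ℕ → X → ℂ := fun n x => ∫ y, k x y * φ n y ∂ν with hg
  have gc : ∀ n, Continuous (g n) ∧ HasCompactSupport (g n) := fun n =>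
    (continuous_hasCompactSupport_integral hX hY hL hk hs (h1 n) (h2 n)).2
  have gm : ∀ n, AEStronglyMeasurable (g n) μ := fun n => (gc n).1.aestronglyMeasurable
  have bound : ∀ n, eLpNorm (g n) 2 μ ≤ ENNReal.ofReal N * eLpNorm (φ n) 2 ν := by
    intro n
    rw [eLpNorm_two_eq ((gc n).1.memLp_of_hasCompactSupport (gc n).2), eLpNorm_two_eq (h3 n),
      ← ENNReal.ofReal_mul hN0]
    refine ENNReal.ofReal_le_ofReal (Real.sqrt_le_iff.2 ⟨by positivity, ?_⟩)
    rw [mul_pow, Real.sq_sqrt (integral_nonneg fun y => by positivity)]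
    exact integral_sq_norm_kernel_le hX hY hL hk hs hc (h1 n) (h2 n)
  have lim : ∀ x, Tendsto (fun n => g n x) atTop (𝓝 (∫ y, k x y * f y ∂ν)) := by
    intro x
    rw [tendsto_iff_edist_tendsto_0]
    have e : ∀ n, edist (g n x) (∫ y, k x y * f y ∂ν) ≤ eLpNorm (k x) 2 ν * eLpNorm (f - φ n) 2 ν := by
      intro n
      rw [edist_comm, edist_eq_enorm_sub]
      simp only [hg]
      rw [← integral_sub (integrable_mul_of_memLp_two (kL x) hf)
          (integrable_mul_of_memLp_two (kL x) (h3 n))]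
      simp only [← mul_sub]
      exact enorm_integral_mul_le (kL x).aestronglyMeasurable
        (hf.aestronglyMeasurable.sub (h3 n).aestronglyMeasurable)
    refine tendsto_of_tendsto_of_tendsto_of_le_of_le tendsto_const_nhds ?_ (fun n => zero_le) e
    simpa using ENNReal.Tendsto.const_mul h4 (Or.inr (kL x).eLpNorm_ne_top)
  have meas : AEStronglyMeasurable (fun x => ∫ y, k x y * f y ∂ν) μ :=
    aestronglyMeasurable_of_tendsto_ae atTop gm (ae_of_all _ lim)
  have le : eLpNorm (fun x => ∫ y, k x y * f y ∂ν) 2 μ ≤ ENNReal.ofReal N * eLpNorm f 2 ν := by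
    refine (Lp.eLpNorm_lim_le_liminf_eLpNorm gm _ (ae_of_all _ lim)).trans ?_
    have b2 : ∀ n, eLpNorm (g n) 2 μ ≤
        ENNReal.ofReal N * (eLpNorm (f - φ n) 2 ν + eLpNorm f 2 ν) := by
      intro n
      refine (bound n).trans ?_
      gcongr
      have : φ n = f - (f - φ n) := by abel
      rw [add_comm]
      conv_lhs => rw [this]
      exact eLpNorm_sub_le hf.aestronglyMeasurable
        (hf.aestronglyMeasurable.sub (h3 n).aestronglyMeasurable) (by norm_num)
    have lim2 : Tendsto (fun n => ENNReal.ofReal N * (eLpNorm (f - φ n) 2 ν + eLpNorm f 2 ν)) atTop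
        (𝓝 (ENNReal.ofReal N * eLpNorm f 2 ν)) := by
      have := ENNReal.Tendsto.const_mul (h4.add_const (eLpNorm f 2 ν))
        (Or.inr (ENNReal.ofReal_ne_top (r := N)))
      simpa using this
    calc liminf (fun n => eLpNorm (g n) 2 μ) atTop
        ≤ liminf (fun n => ENNReal.ofReal N * (eLpNorm (f - φ n) 2 ν + eLpNorm f 2 ν)) atTop :=
          liminf_le_liminf (Eventually.of_forall b2)
      _ = _ := lim2.liminf_eq
  exact ⟨⟨meas, le.trans_lt (ENNReal.mul_lt_top ENNReal.ofReal_lt_top hf.eLpNorm_lt_top)⟩, le⟩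

theorem exists_isKernel [μ.IsAddHaarMeasure] [ν.IsAddHaarMeasure] [ν.Regular]
    (hX : IsClosedEmbedding iX) (hY : IsClosedEmbedding iY) {L : Set G} (hL : IsCompact L)
    {k : X → Y → ℂ} (hk : Continuous (Function.uncurry k))
    (hs : ∀ x y, k x y ≠ 0 → iX x - iY y ∈ L) {c : ℝ} (hc : ∀ x y, ‖k x y‖ ≤ c) :
    ∃ T : Lp ℂ 2 ν →L[ℂ] Lp ℂ 2 μ, IsKernel μ ν k T ∧ ‖T‖ ≤ c * schurConst iX iY μ ν L := by
  have hc0 : 0 ≤ c := (norm_nonneg _).trans (hc 0 0)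
  have hN0 : 0 ≤ c * schurConst iX iY μ ν L := mul_nonneg hc0 (Real.sqrt_nonneg _)
  have kx : ∀ x, Continuous (k x) := fun x => hk.comp (by fun_prop : Continuous fun y => (x, y))
  have kL : ∀ x, MemLp (k x) 2 ν := fun x =>
    (kx x).memLp_of_hasCompactSupport (hasCompactSupport_slice hY hL (iX x) (hs x))
  have H := fun f : Lp ℂ 2 ν => memLp_kernel (μ := μ) hX hY hL hk hs hc (Lp.memLp f)
  let T₀ : Lp ℂ 2 ν →ₗ[ℂ] Lp ℂ 2 μ :=
    { toFun := fun f => (H f).1.toLp _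
      map_add' := fun f g => by
        rw [← MemLp.toLp_add]
        congr 1
        funext x
        rw [Pi.add_apply, ← integral_add (integrable_mul_of_memLp_two (kL x) (Lp.memLp f))
          (integrable_mul_of_memLp_two (kL x) (Lp.memLp g))]
        refine integral_congr_ae ?_
        filter_upwards [Lp.coeFn_add f g] with y hy
        rw [hy, Pi.add_apply, mul_add]
      map_smul' := fun a f => by
        rw [RingHom.id_apply, ← MemLp.toLp_const_smul]
        congr 1
        funext x
        rw [Pi.smul_apply, ← integral_smul]
        refine integral_congr_ae ?_
        filter_upwards [Lp.coeFn_smul a f] with y hy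
        rw [hy, Pi.smul_apply, smul_eq_mul, smul_eq_mul]; ring }
  refine ⟨T₀.mkContinuous _ fun f => ?_, fun f => (H f).1.coeFn_toLp,
    T₀.mkContinuous_norm_le hN0 _⟩
  change ‖(H f).1.toLp _‖ ≤ _
  rw [Lp.norm_toLp, Lp.norm_def, ← ENNReal.toReal_ofReal hN0, ← ENNReal.toReal_mul]
  exact ENNReal.toReal_mono (ENNReal.mul_ne_top ENNReal.ofReal_ne_top (Lp.eLpNorm_ne_top f)) (H f).2

theorem IsKernel.unique {k : X → Y → ℂ} {T T' : Lp ℂ 2 ν →L[ℂ] Lp ℂ 2 μ} (h : IsKernel μ ν k T)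
    (h' : IsKernel μ ν k T') : T = T' := by
  ext1 f
  exact Lp.ext ((h f).trans (h' f).symm)

theorem IsKernel.norm_le [μ.IsAddHaarMeasure] [ν.IsAddHaarMeasure] [ν.Regular]
    (hX : IsClosedEmbedding iX) (hY : IsClosedEmbedding iY) {L : Set G} (hL : IsCompact L)
    {k : X → Y → ℂ} (hk : Continuous (Function.uncurry k))
    (hs : ∀ x y, k x y ≠ 0 → iX x - iY y ∈ L) {c : ℝ} (hc : ∀ x y, ‖k x y‖ ≤ c)
    {T : Lp ℂ 2 ν →L[ℂ] Lp ℂ 2 μ} (hT : IsKernel μ ν k T) :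
    ‖T‖ ≤ c * schurConst iX iY μ ν L := by
  obtain ⟨T', h1, h2⟩ := exists_isKernel (μ := μ) (ν := ν) hX hY hL hk hs hc
  rwa [hT.unique h1]

end Kernels
-- Multiplication operators and linear operations on kernels.
/-- `M` is the operator of multiplication by `b`. -/
def IsMul {X : Type*} [MeasurableSpace X] (μ : Measure X) (b : X → ℂ)
    (M : Lp ℂ 2 μ →L[ℂ] Lp ℂ 2 μ) : Prop :=
  ∀ f : Lp ℂ 2 μ, M f =ᵐ[μ] fun x => b x * f x

section Mul

variable {X : Type*} [MeasurableSpace X] {μ : Measure X}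

theorem exists_isMul {b : X → ℂ} (hb : AEStronglyMeasurable b μ) {c : ℝ} (hc : ∀ x, ‖b x‖ ≤ c)
    (hc0 : 0 ≤ c) : ∃ M : Lp ℂ 2 μ →L[ℂ] Lp ℂ 2 μ, IsMul μ b M ∧ ‖M‖ ≤ c := by
  have bd : ∀ (f : Lp ℂ 2 μ) x, ‖b x * f x‖ ≤ c * ‖f x‖ := fun f x => by
    rw [norm_mul]; gcongr; exact hc x
  have H : ∀ f : Lp ℂ 2 μ, MemLp (fun x => b x * f x) 2 μ := fun f =>
    (Lp.memLp f).of_le_mul (hb.mul (Lp.aestronglyMeasurable f)) (ae_of_all _ (bd f))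
  let T₀ : Lp ℂ 2 μ →ₗ[ℂ] Lp ℂ 2 μ :=
    { toFun := fun f => (H f).toLp _
      map_add' := fun f g => by
        rw [← MemLp.toLp_add]
        refine MemLp.toLp_congr _ _ ?_
        filter_upwards [Lp.coeFn_add f g] with y hy
        rw [hy, Pi.add_apply, Pi.add_apply, mul_add]
      map_smul' := fun a f => by
        rw [RingHom.id_apply, ← MemLp.toLp_const_smul]
        refine MemLp.toLp_congr _ _ ?_
        filter_upwards [Lp.coeFn_smul a f] with y hy
        rw [hy, Pi.smul_apply, Pi.smul_apply, smul_eq_mul, smul_eq_mul]; ring }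
  refine ⟨T₀.mkContinuous c fun f => ?_, fun f => (H f).coeFn_toLp,
    T₀.mkContinuous_norm_le hc0 _⟩
  refine Lp.norm_le_mul_norm_of_ae_le_mul ?_
  filter_upwards [(H f).coeFn_toLp] with x hx
  exact (congrArg norm hx).trans_le (bd f x)

theorem IsMul.unique {b : X → ℂ} {M M' : Lp ℂ 2 μ →L[ℂ] Lp ℂ 2 μ} (h : IsMul μ b M)
    (h' : IsMul μ b M') : M = M' := by
  ext1 f
  exact Lp.ext ((h f).trans (h' f).symm)

theorem IsMul.norm_le {b : X → ℂ} {M : Lp ℂ 2 μ →L[ℂ] Lp ℂ 2 μ} (h : IsMul μ b M) {c : ℝ}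
    (hc0 : 0 ≤ c) (hc : ∀ x, ‖b x‖ ≤ c) : ‖M‖ ≤ c := by
  refine M.opNorm_le_bound hc0 fun f => Lp.norm_le_mul_norm_of_ae_le_mul ?_
  filter_upwards [h f] with x hx
  rw [hx, norm_mul]
  gcongr
  exact hc x

theorem IsMul.sub {b b' : X → ℂ} {M M' : Lp ℂ 2 μ →L[ℂ] Lp ℂ 2 μ} (h : IsMul μ b M)
    (h' : IsMul μ b' M') : IsMul μ (fun x => b x - b' x) (M - M') := by
  intro f
  rw [sub_apply]
  filter_upwards [h f, h' f, Lp.coeFn_sub (M f) (M' f)] with x h1 h2 h3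
  rw [h3, Pi.sub_apply, h1, h2, sub_mul]

theorem IsMul.comp {b b' : X → ℂ} {M M' : Lp ℂ 2 μ →L[ℂ] Lp ℂ 2 μ} (h : IsMul μ b M)
    (h' : IsMul μ b' M') : IsMul μ (fun x => b x * b' x) (M ∘L M') := by
  intro f
  rw [ContinuousLinearMap.comp_apply]
  filter_upwards [h (M' f), h' f] with x h1 h2
  rw [h1, h2, mul_assoc]

theorem IsMul.adjoint {b : X → ℂ} {M : Lp ℂ 2 μ →L[ℂ] Lp ℂ 2 μ} (h : IsMul μ b M)
    (hb : AEStronglyMeasurable b μ) {c : ℝ} (hc : ∀ x, ‖b x‖ ≤ c) (hc0 : 0 ≤ c) :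
    IsMul μ (fun x => starRingEnd ℂ (b x)) (ContinuousLinearMap.adjoint M) := by
  obtain ⟨S, hS, -⟩ := exists_isMul (μ := μ) (b := fun x => starRingEnd ℂ (b x))
    (Complex.continuous_conj.comp_aestronglyMeasurable hb) (c := c) (by simpa using hc) hc0
  have : S = ContinuousLinearMap.adjoint M := by
    rw [ContinuousLinearMap.eq_adjoint_iff]
    intro f g
    rw [L2.inner_def, L2.inner_def]
    refine integral_congr_ae ?_
    filter_upwards [hS f, h g] with x h1 h2
    rw [h1, h2, RCLike.inner_apply, RCLike.inner_apply, map_mul, Complex.conj_conj]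
    ring
  rwa [← this]

theorem IsKernel.comp_isMul {Y : Type*} [MeasurableSpace Y] {ν : Measure Y} {k : X → Y → ℂ}
    {b : Y → ℂ} {T : Lp ℂ 2 ν →L[ℂ] Lp ℂ 2 μ} {M : Lp ℂ 2 ν →L[ℂ] Lp ℂ 2 ν} (h : IsKernel μ ν k T)
    (h' : IsMul ν b M) : IsKernel μ ν (fun x y => k x y * b y) (T ∘L M) := by
  intro f
  rw [ContinuousLinearMap.comp_apply]
  filter_upwards [h (M f)] with x h1
  rw [h1]
  refine integral_congr_ae ?_
  filter_upwards [h' f] with y hy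
  rw [hy, mul_assoc]

theorem IsKernel.sub {Y : Type*} [MeasurableSpace Y] {ν : Measure Y} {k k' : X → Y → ℂ}
    {T T' : Lp ℂ 2 ν →L[ℂ] Lp ℂ 2 μ} (h : IsKernel μ ν k T) (h' : IsKernel μ ν k' T')
    (hk : ∀ x, MemLp (k x) 2 ν) (hk' : ∀ x, MemLp (k' x) 2 ν) :
    IsKernel μ ν (fun x y => k x y - k' x y) (T - T') := by
  intro f
  rw [sub_apply]
  filter_upwards [h f, h' f, Lp.coeFn_sub (T f) (T' f)] with x h1 h2 h3
  rw [h3, Pi.sub_apply, h1, h2, ← integral_sub (integrable_mul_of_memLp_two (hk x) (Lp.memLp f))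
    (integrable_mul_of_memLp_two (hk' x) (Lp.memLp f))]
  simp only [sub_mul]

theorem IsKernel.add {Y : Type*} [MeasurableSpace Y] {ν : Measure Y} {k k' : X → Y → ℂ}
    {T T' : Lp ℂ 2 ν →L[ℂ] Lp ℂ 2 μ} (h : IsKernel μ ν k T) (h' : IsKernel μ ν k' T')
    (hk : ∀ x, MemLp (k x) 2 ν) (hk' : ∀ x, MemLp (k' x) 2 ν) :
    IsKernel μ ν (fun x y => k x y + k' x y) (T + T') := by
  intro f
  rw [add_apply]
  filter_upwards [h f, h' f, Lp.coeFn_add (T f) (T' f)] with x h1 h2 h3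
  rw [h3, Pi.add_apply, h1, h2, ← integral_add (integrable_mul_of_memLp_two (hk x) (Lp.memLp f))
    (integrable_mul_of_memLp_two (hk' x) (Lp.memLp f))]
  simp only [add_mul]

theorem IsKernel.sum {Y ι : Type*} [MeasurableSpace Y] {ν : Measure Y} {k : ι → X → Y → ℂ}
    {T : ι → Lp ℂ 2 ν →L[ℂ] Lp ℂ 2 μ} (s : Finset ι) (h : ∀ i ∈ s, IsKernel μ ν (k i) (T i))
    (hk : ∀ i ∈ s, ∀ x, MemLp (k i x) 2 ν) :
    IsKernel μ ν (fun x y => ∑ i ∈ s, k i x y) (∑ i ∈ s, T i) := by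
  classical
  induction s using Finset.induction_on with
  | empty =>
    intro f
    simp only [Finset.sum_empty, zero_apply, zero_mul, integral_zero]
    exact Lp.coeFn_zero ℂ 2 μ
  | insert a s ha ih =>
    simp only [Finset.sum_insert ha]
    refine (h a (Finset.mem_insert_self _ _)).add
      (ih (fun i hi => h i (Finset.mem_insert_of_mem hi))
        (fun i hi => hk i (Finset.mem_insert_of_mem hi)))
      (hk a (Finset.mem_insert_self _ _)) fun x => ?_
    exact memLp_finsetSum s fun i hi => hk i (Finset.mem_insert_of_mem hi) x

end Mul

/-! ### Products and adjoints of kernel operators, by reduction to C_c. -/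

theorem Lp_induction_of_hasCompactSupport {Y : Type*} [TopologicalSpace Y]
    [LocallyCompactSpace Y] [T2Space Y] [MeasurableSpace Y] [BorelSpace Y] {ν : Measure Y}
    [ν.Regular] {P : Lp ℂ 2 ν → Prop} (hP : IsClosed {f | P f})
    (h : ∀ (φ : Y → ℂ) (hφ : MemLp φ 2 ν), Continuous φ → HasCompactSupport φ → P (hφ.toLp φ))
    (f : Lp ℂ 2 ν) : P f := by
  obtain ⟨φ, h1, h2, h3, h4⟩ := exists_seq_hasCompactSupport (Lp.memLp f)
  refine hP.mem_of_tendsto (f := fun n => (h3 n).toLp (φ n)) (b := atTop) ?_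
    (Eventually.of_forall fun n => h _ (h3 n) (h1 n) (h2 n))
  rw [tendsto_iff_edist_tendsto_0]
  refine h4.congr fun n => ?_
  rw [edist_comm, Lp.edist_def]
  refine eLpNorm_congr_ae ?_
  filter_upwards [(h3 n).coeFn_toLp] with y hy
  rw [Pi.sub_apply, Pi.sub_apply, hy]

theorem continuous_integral_of_locally_compact_support {P Z : Type*} [TopologicalSpace P]
    [TopologicalSpace Z] [MeasurableSpace Z] [OpensMeasurableSpace Z] {ρ : Measure Z}
    [IsFiniteMeasureOnCompacts ρ] {F : P → Z → ℂ} (hF : Continuous (Function.uncurry F))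
    (h : ∀ p, ∃ U ∈ 𝓝 p, ∃ K, IsCompact K ∧ ∀ q ∈ U, ∀ z, z ∉ K → F q z = 0) :
    Continuous fun p => ∫ z, F p z ∂ρ := by
  rw [continuous_iff_continuousAt]
  intro p
  obtain ⟨U, hU, K, hK, hz⟩ := h p
  exact (continuousOn_integral_of_compact_support hK hF.continuousOn
    fun q z hq hz' => hz q hq z hz').continuousAt hU

section Kernels

variable {G X Y Z : Type*}
  [AddCommGroup G] [TopologicalSpace G] [IsTopologicalAddGroup G] [LocallyCompactSpace G]
  [T2Space G]
  [AddCommGroup X] [TopologicalSpace X] [IsTopologicalAddGroup X] [LocallyCompactSpace X]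
  [T2Space X] [MeasurableSpace X] [BorelSpace X]
  [AddCommGroup Y] [TopologicalSpace Y] [IsTopologicalAddGroup Y] [LocallyCompactSpace Y]
  [T2Space Y] [MeasurableSpace Y] [BorelSpace Y]
  [AddCommGroup Z] [TopologicalSpace Z] [IsTopologicalAddGroup Z] [LocallyCompactSpace Z]
  [T2Space Z] [MeasurableSpace Z] [BorelSpace Z]
  {iX : X →+ G} {iY : Y →+ G} {iZ : Z →+ G}
  {μ : Measure X} {ν : Measure Y} {ρ : Measure Z}

theorem memLp_slice [IsFiniteMeasureOnCompacts ν] (hY : IsClosedEmbedding iY) {L : Set G}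
    (hL : IsCompact L) {k : X → Y → ℂ} (hk : Continuous (Function.uncurry k))
    (hs : ∀ x y, k x y ≠ 0 → iX x - iY y ∈ L) (x : X) : MemLp (k x) 2 ν :=
  (hk.comp (by fun_prop : Continuous fun y => (x, y))).memLp_of_hasCompactSupport
    (hasCompactSupport_slice hY hL (iX x) (hs x))

theorem continuous_compKernel [IsFiniteMeasureOnCompacts ρ] (hX : IsClosedEmbedding iX)
    (hZ : IsClosedEmbedding iZ) {L : Set G} (hL : IsCompact L) {k : X → Z → ℂ} {k' : Z → Y → ℂ}
    (hk : Continuous (Function.uncurry k)) (hk' : Continuous (Function.uncurry k'))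
    (hs : ∀ x z, k x z ≠ 0 → iX x - iZ z ∈ L) :
    Continuous (Function.uncurry fun x y => ∫ z, k x z * k' z y ∂ρ) := by
  refine continuous_integral_of_locally_compact_support (F := fun (p : X × Y) z =>
    k p.1 z * k' z p.2) ?_ fun p => ?_
  · exact (hk.comp (by fun_prop : Continuous fun q : (X × Y) × Z => (q.1.1, q.2))).mul
      (hk'.comp (by fun_prop : Continuous fun q : (X × Y) × Z => (q.2, q.1.2)))
  · obtain ⟨U, hUc, hU⟩ := exists_compact_mem_nhds p.1
    refine ⟨U ×ˢ Set.univ, prod_mem_nhds hU univ_mem, iZ ⁻¹' (iX '' U - L),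
      hZ.isCompact_preimage (isCompact_sub (hUc.image hX.continuous) hL), fun q hq z hz => ?_⟩
    by_contra h
    exact hz ⟨_, ⟨q.1, hq.1, rfl⟩, _, hs _ _ (left_ne_zero_of_mul h), by simp⟩

theorem compKernel_mem {L L' : Set G} {k : X → Z → ℂ} {k' : Z → Y → ℂ}
    (hs : ∀ x z, k x z ≠ 0 → iX x - iZ z ∈ L) (hs' : ∀ z y, k' z y ≠ 0 → iZ z - iY y ∈ L')
    (x : X) (y : Y) (h : ∫ z, k x z * k' z y ∂ρ ≠ 0) : iX x - iY y ∈ L + L' := by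
  obtain ⟨z, hz⟩ : ∃ z, k x z * k' z y ≠ 0 := by
    by_contra! h'
    exact h (by simp [h'])
  exact ⟨_, hs x z (left_ne_zero_of_mul hz), _, hs' z y (right_ne_zero_of_mul hz), by simp⟩

/-- The composed kernel satisfies the hypotheses of Schur's test, so it already defines a bounded
operator. That operator only has to be compared with the product on the dense subspace C_c, where
the order of integration may be exchanged. -/
theorem IsKernel.comp [μ.IsAddHaarMeasure] [ν.IsAddHaarMeasure] [ν.Regular] [ρ.IsAddHaarMeasure]
    (hX : IsClosedEmbedding iX) (hY : IsClosedEmbedding iY) (hZ : IsClosedEmbedding iZ)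
    {L L' : Set G} (hL : IsCompact L) (hL' : IsCompact L') {k : X → Z → ℂ} {k' : Z → Y → ℂ}
    (hk : Continuous (Function.uncurry k)) (hk' : Continuous (Function.uncurry k'))
    (hs : ∀ x z, k x z ≠ 0 → iX x - iZ z ∈ L) (hs' : ∀ z y, k' z y ≠ 0 → iZ z - iY y ∈ L')
    {c c' : ℝ} (hc : ∀ x z, ‖k x z‖ ≤ c) (hc' : ∀ z y, ‖k' z y‖ ≤ c')
    {T : Lp ℂ 2 ρ →L[ℂ] Lp ℂ 2 μ} {T' : Lp ℂ 2 ν →L[ℂ] Lp ℂ 2 ρ}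
    (hT : IsKernel μ ρ k T) (hT' : IsKernel ρ ν k' T') :
    IsKernel μ ν (fun x y => ∫ z, k x z * k' z y ∂ρ) (T ∘L T') := by
  have kx : ∀ x, Continuous (k x) := fun x => hk.comp (by fun_prop : Continuous fun z => (x, z))
  have hc0 : 0 ≤ c := (norm_nonneg _).trans (hc 0 0)
  have hc0' : 0 ≤ c' := (norm_nonneg _).trans (hc' 0 0)
  have bd : ∀ x y, ‖∫ z, k x z * k' z y ∂ρ‖ ≤ (c * c') * ρ.real (iZ ⁻¹' (L - L)) := by
    intro x y
    refine (norm_integral_le_integral_norm _).trans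
      (integral_le_of_support_sub hZ (isCompact_sub hL hL) (fun _ => norm_nonneg _)
        (fun z => ?_) fun z z' h h' => ?_)
    · rw [norm_mul]; exact mul_le_mul (hc x z) (hc' z y) (norm_nonneg _) hc0
    · exact ⟨_, hs x z' (left_ne_zero_of_mul (norm_ne_zero_iff.1 h')), _,
        hs x z (left_ne_zero_of_mul (norm_ne_zero_iff.1 h)), by simp⟩
  obtain ⟨S, hS, -⟩ := exists_isKernel (μ := μ) (ν := ν) hX hY (hL.add hL')
    (continuous_compKernel (ρ := ρ) hX hZ hL hk hk' hs) (compKernel_mem hs hs') bd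
  have : T ∘L T' = S := by
    ext1 f
    refine Lp_induction_of_hasCompactSupport (P := fun f => (T ∘L T') f = S f)
      (isClosed_eq (ContinuousLinearMap.continuous _) (ContinuousLinearMap.continuous _))
      (fun φ hφ φc φs => ?_) f
    obtain ⟨h1, h2, h3⟩ :=
      continuous_hasCompactSupport_integral (ν := ν) hZ hY hL' hk' hs' φc φs
    refine Lp.ext ?_
    rw [ContinuousLinearMap.comp_apply]
    filter_upwards [hT (T' (hφ.toLp φ)), hS (hφ.toLp φ)] with x hx1 hx2
    rw [hx1, hx2]
    have e1 : ∫ z, k x z * (T' (hφ.toLp φ)) z ∂ρ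
        = ∫ z, ∫ y, k x z * (k' z y * φ y) ∂ν ∂ρ := by
      refine integral_congr_ae ?_
      filter_upwards [hT' (hφ.toLp φ)] with z hz
      rw [hz, ← integral_const_mul]
      refine integral_congr_ae ?_
      filter_upwards [hφ.coeFn_toLp] with y hy
      rw [hy]
    have e2 : ∫ y, (∫ z, k x z * k' z y ∂ρ) * (hφ.toLp φ) y ∂ν
        = ∫ y, ∫ z, k x z * (k' z y * φ y) ∂ρ ∂ν := by
      refine integral_congr_ae ?_
      filter_upwards [hφ.coeFn_toLp] with y hy
      rw [hy, ← integral_mul_const]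
      simp only [mul_assoc]
    rw [e1, e2]
    refine integral_integral_swap_of_hasCompactSupport ?_ (h1.mono fun p hp h => hp ?_)
    · exact ((kx x).comp continuous_fst).mul (hk'.mul (φc.comp continuous_snd))
    · simp only [Function.uncurry] at h ⊢
      rw [h, mul_zero]
  rwa [this]

theorem IsKernel.adjoint [μ.IsAddHaarMeasure] [ν.IsAddHaarMeasure] [ν.Regular] [μ.Regular]
    (hX : IsClosedEmbedding iX) (hY : IsClosedEmbedding iY)
    {L : Set G} (hL : IsCompact L) {k : X → Y → ℂ} (hk : Continuous (Function.uncurry k))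
    (hs : ∀ x y, k x y ≠ 0 → iX x - iY y ∈ L) {c : ℝ} (hc : ∀ x y, ‖k x y‖ ≤ c)
    {T : Lp ℂ 2 ν →L[ℂ] Lp ℂ 2 μ} (hT : IsKernel μ ν k T) :
    IsKernel ν μ (fun y x => starRingEnd ℂ (k x y)) (ContinuousLinearMap.adjoint T) := by
  obtain ⟨S, hS, -⟩ := exists_isKernel (μ := ν) (ν := μ) (k := fun y x => starRingEnd ℂ (k x y))
    hY hX hL.neg
    (Complex.continuous_conj.comp (hk.comp continuous_swap))
    (fun y x h => by simpa using hs x y (by simpa using h))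
    (c := c) (fun y x => by simpa using hc x y)
  have : S = ContinuousLinearMap.adjoint T := by
    rw [ContinuousLinearMap.eq_adjoint_iff]
    intro g f
    refine Lp_induction_of_hasCompactSupport (P := fun g => inner ℂ (S g) f = inner ℂ g (T f))
      (isClosed_eq (by fun_prop) (by fun_prop)) (fun γ hγ γc γs => ?_) g
    refine Lp_induction_of_hasCompactSupport
      (P := fun f => inner ℂ (S (hγ.toLp γ)) f = inner ℂ (hγ.toLp γ) (T f))
      (isClosed_eq (by fun_prop) (by fun_prop)) (fun φ hφ φc φs => ?_) f
    rw [L2.inner_def, L2.inner_def]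
    have e1 : ∫ y, inner ℂ ((S (hγ.toLp γ)) y) ((hφ.toLp φ) y) ∂ν
        = ∫ y, ∫ x, k x y * φ y * starRingEnd ℂ (γ x) ∂μ ∂ν := by
      refine integral_congr_ae ?_
      filter_upwards [hS (hγ.toLp γ), hφ.coeFn_toLp] with y h1 h2
      rw [h1, h2, RCLike.inner_apply, ← integral_conj, ← integral_const_mul]
      refine integral_congr_ae ?_
      filter_upwards [hγ.coeFn_toLp] with x hx
      rw [hx, map_mul, Complex.conj_conj]; ring
    have e2 : ∫ x, inner ℂ ((hγ.toLp γ) x) ((T (hφ.toLp φ)) x) ∂μ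
        = ∫ x, ∫ y, k x y * φ y * starRingEnd ℂ (γ x) ∂ν ∂μ := by
      refine integral_congr_ae ?_
      filter_upwards [hT (hφ.toLp φ), hγ.coeFn_toLp] with x h1 h2
      rw [h1, h2, RCLike.inner_apply, ← integral_mul_const]
      refine integral_congr_ae ?_
      filter_upwards [hφ.coeFn_toLp] with y hy
      rw [hy]
    rw [e1, e2]
    symm
    refine integral_integral_swap_of_hasCompactSupport ?_
      ((continuous_hasCompactSupport_integral (ν := ν) hX hY hL hk hs φc φs).1.mono
        fun p hp h => hp ?_)
    · exact (hk.mul (φc.comp continuous_snd)).mul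
        (Complex.continuous_conj.comp (γc.comp continuous_fst))
    · simp only [Function.uncurry] at h ⊢
      rw [h, zero_mul]
  rwa [← this]

end Kernels

/-! ### Compatibility, partitions of unity and lifting of compact sets. -/

/-- The homomorphism `(y, z) ↦ y - z` is open onto its range in `G`. -/
def Compat {G Y Z : Type*} [AddCommGroup G] [TopologicalSpace G] [AddCommGroup Y]
    [TopologicalSpace Y] [AddCommGroup Z] [TopologicalSpace Z] (iY : Y →+ G) (iZ : Z →+ G) : Prop :=
  ∀ p : Y × Z, 𝓝[Set.range fun q : Y × Z => iY q.1 - iZ q.2] (iY p.1 - iZ p.2) ≤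
    map (fun q : Y × Z => iY q.1 - iZ q.2) (𝓝 p)

/-- Compatibility involves the ambient group only through the topology induced on the range of the
difference map, so it can be moved from one ambient group to another. -/
theorem Compat.comp_iff {G G' Y Z : Type*} [AddCommGroup G] [TopologicalSpace G] [AddCommGroup G']
    [TopologicalSpace G'] [AddCommGroup Y] [TopologicalSpace Y] [AddCommGroup Z]
    [TopologicalSpace Z] {iY : Y →+ G} {iZ : Z →+ G} {j : G →+ G'} (hj : IsEmbedding j) :
    Compat (j.comp iY) (j.comp iZ) ↔ Compat iY iZ := by
  refine forall_congr' fun p => ?_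
  have e : (fun q : Y × Z => j.comp iY q.1 - j.comp iZ q.2)
      = j ∘ fun q : Y × Z => iY q.1 - iZ q.2 := by
    funext q; simp
  have e' : j.comp iY p.1 - j.comp iZ p.2 = j (iY p.1 - iZ p.2) := by simp
  rw [e, e', Set.range_comp, ← hj.map_nhdsWithin_eq, ← Filter.map_map,
    Filter.map_le_map_iff hj.injective]

/-- In a locally compact Hausdorff space, finitely many bumps that are subordinate to given
neighbourhoods and sum up to one on a given compact set. -/
theorem exists_bumps {Q : Type*} [TopologicalSpace Q] [LocallyCompactSpace Q] [T2Space Q]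
    {K : Set Q} (hK : IsCompact K) (U : Q → Set Q) (hU : ∀ x ∈ K, U x ∈ 𝓝 x) :
    ∃ (n : ℕ) (a : Fin n → Q) (χ : Fin n → Q → ℝ), (∀ i, a i ∈ K) ∧ (∀ i, Continuous (χ i)) ∧
      (∀ i, HasCompactSupport (χ i)) ∧ (∀ i x, χ i x ≠ 0 → x ∈ U (a i)) ∧ (∀ i x, 0 ≤ χ i x) ∧
      (∀ x, ∑ i, χ i x ≤ 1) ∧ ∀ x ∈ K, ∑ i, χ i x = 1 := by
  obtain ⟨t, htK, ht⟩ := hK.elim_nhds_subcover (fun x => interior (U x))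
    fun x hx => interior_mem_nhds.2 (hU x hx)
  set n := t.card
  let e : Fin n ≃ t := t.equivFin.symm
  have hcov : K ⊆ ⋃ i, interior (U (e i)) := by
    intro x hx
    obtain ⟨y, hy, hxy⟩ := Set.mem_iUnion₂.1 (ht hx)
    exact Set.mem_iUnion.2 ⟨e.symm ⟨y, hy⟩, by simpa using hxy⟩
  obtain ⟨f, hf, hfc⟩ := PartitionOfUnity.exists_isSubordinate_of_locallyFinite_t2space hK
    (fun i => interior (U (e i))) (fun i => isOpen_interior) (locallyFinite_of_finite _) hcov
  refine ⟨n, fun i => e i, fun i => f i, fun i => htK _ (e i).2, fun i => (f i).continuous, hfc,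
    fun i x hx => interior_subset (hf i (subset_tsupport _ hx)), fun i x => f.nonneg i x,
    fun x => ?_, fun x hx => ?_⟩
  · simpa [finsum_eq_sum_of_fintype] using f.sum_le_one x
  · simpa [finsum_eq_sum_of_fintype] using f.sum_eq_one hx

theorem exists_cutoff {Q : Type*} [TopologicalSpace Q] [LocallyCompactSpace Q] [T2Space Q]
    {K : Set Q} (hK : IsCompact K) : ∃ χ : Q → ℝ, Continuous χ ∧ HasCompactSupport χ ∧
      (∀ x, 0 ≤ χ x) ∧ (∀ x, χ x ≤ 1) ∧ ∀ x ∈ K, χ x = 1 := by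
  obtain ⟨f, h1, -, h2, h3⟩ := exists_continuous_one_zero_of_isCompact hK isClosed_empty
    (Set.disjoint_empty K)
  exact ⟨f, f.continuous, h2, fun x => (h3 x).1, fun x => (h3 x).2, fun x hx => h1 hx⟩

theorem exists_compact_lift_of_isOpenMap {A B : Type*} [TopologicalSpace A]
    [LocallyCompactSpace A] [TopologicalSpace B] {q : A → B} (hq : IsOpenMap q)
    (hs : Function.Surjective q) {K : Set B} (hK : IsCompact K) :
    ∃ C : Set A, IsCompact C ∧ ∀ b ∈ K, ∃ a ∈ C, q a = b := by
  refine hK.induction_on (p := fun s => ∃ C : Set A, IsCompact C ∧ ∀ b ∈ s, ∃ a ∈ C, q a = b)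
    ⟨∅, isCompact_empty, by simp⟩ ?_ ?_ ?_
  · rintro s t hst ⟨C, hC, h⟩
    exact ⟨C, hC, fun b hb => h b (hst hb)⟩
  · rintro s t ⟨C, hC, h⟩ ⟨C', hC', h'⟩
    refine ⟨C ∪ C', hC.union hC', fun b hb => ?_⟩
    rcases hb with hb | hb
    · obtain ⟨a, ha, e⟩ := h b hb; exact ⟨a, Or.inl ha, e⟩
    · obtain ⟨a, ha, e⟩ := h' b hb; exact ⟨a, Or.inr ha, e⟩
  · intro b _
    obtain ⟨a, rfl⟩ := hs b
    obtain ⟨N, hN, hNa⟩ := exists_compact_mem_nhds a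
    exact ⟨q '' N, mem_nhdsWithin_of_mem_nhds (hq.image_mem_nhds hNa), N, hN, fun b hb => hb⟩

section Kernels

variable {G X Y Z : Type*}
  [AddCommGroup G] [TopologicalSpace G] [IsTopologicalAddGroup G] [LocallyCompactSpace G]
  [T2Space G]
  [AddCommGroup X] [TopologicalSpace X] [IsTopologicalAddGroup X] [LocallyCompactSpace X]
  [T2Space X] [MeasurableSpace X] [BorelSpace X]
  [AddCommGroup Y] [TopologicalSpace Y] [IsTopologicalAddGroup Y] [LocallyCompactSpace Y]
  [T2Space Y] [MeasurableSpace Y] [BorelSpace Y]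
  [AddCommGroup Z] [TopologicalSpace Z] [IsTopologicalAddGroup Z] [LocallyCompactSpace Z]
  [T2Space Z] [MeasurableSpace Z] [BorelSpace Z]
  {iX : X →+ G} {iY : Y →+ G} {iZ : Z →+ G}
  {μ : Measure X} {ν : Measure Y} {ρ : Measure Z}

/-- A locally compact subgroup is closed: openness provides a compact neighbourhood of 0 in the
range, and a point of the closure can be translated by a point of the range into the closure of that
neighbourhood. -/
theorem Compat.isClosed_range (h : Compat iY iZ) (hY : Continuous iY) (hZ : Continuous iZ) :
    IsClosed (Set.range fun q : Y × Z => iY q.1 - iZ q.2) := by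
  set d : Y × Z → G := fun q => iY q.1 - iZ q.2 with hd
  have dc : Continuous d := by fun_prop
  have d0 : d 0 = 0 := by simp [hd]
  obtain ⟨N, hN, hN0⟩ := exists_compact_mem_nhds (0 : Y × Z)
  have h0 : d '' N ∈ 𝓝[Set.range d] (0 : G) := by
    have := h 0 (image_mem_map hN0)
    simpa using this
  obtain ⟨V, hV, hV0, hVN⟩ := mem_nhdsWithin.1 h0
  refine closure_subset_iff_isClosed.1 fun g hg => ?_
  have hU : {r | g - r ∈ V} ∈ 𝓝 g :=
    (by fun_prop : Continuous fun r => g - r).continuousAt.preimage_mem_nhds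
      (by simpa using hV.mem_nhds hV0)
  obtain ⟨_, hr, ⟨r, rfl⟩⟩ := mem_closure_iff_nhds.1 hg _ hU
  have hcl : g - d r ∈ closure (Set.range d) := by
    have : closure (Set.range d) ⊆ (fun x => x - d r) ⁻¹' closure (Set.range d) := by
      refine closure_minimal ?_ (isClosed_closure.preimage (by fun_prop))
      rintro _ ⟨q, rfl⟩
      exact subset_closure ⟨q - r, by simp [hd]; abel⟩
    exact this hg
  have h1 : g - d r ∈ closure (d '' N) :=
    closure_mono hVN (hV.inter_closure ⟨hr, hcl⟩)
  rw [(hN.image dc).isClosed.closure_eq] at h1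
  obtain ⟨q, -, hq⟩ := h1
  refine ⟨q + r, ?_⟩
  have : d (q + r) = d q + d r := by simp [hd]; abel
  change d (q + r) = g
  rw [this, hq]; abel

theorem Compat.exists_compact_lift_prod (h : Compat iY iZ) (hY : Continuous iY) (hZ : Continuous iZ)
    {K : Set G} (hK : IsCompact K) :
    ∃ C : Set (Y × Z), IsCompact C ∧ ∀ y z, iY y - iZ z ∈ K →
      ∃ q ∈ C, iY q.1 - iZ q.2 = iY y - iZ z := by
  set d : Y × Z → G := fun q => iY q.1 - iZ q.2 with hd
  suffices key : ∃ C : Set (Y × Z), IsCompact C ∧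
      ∀ b ∈ (K ∩ Set.range d) ∩ Set.range d, ∃ a ∈ C, d a = b by
    obtain ⟨C, hC, hl⟩ := key
    exact ⟨C, hC, fun y z hyz => hl _ ⟨⟨hyz, ⟨(y, z), rfl⟩⟩, ⟨(y, z), rfl⟩⟩⟩
  refine (hK.inter_right (h.isClosed_range hY hZ)).induction_on (p := fun s =>
    ∃ C : Set (Y × Z), IsCompact C ∧ ∀ b ∈ s ∩ Set.range d, ∃ a ∈ C, d a = b) ?_ ?_ ?_ ?_
  · exact ⟨∅, isCompact_empty, by simp⟩
  · rintro s t hst ⟨C, hC, h⟩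
    exact ⟨C, hC, fun b hb => h b ⟨hst hb.1, hb.2⟩⟩
  · rintro s t ⟨C, hC, h⟩ ⟨C', hC', h'⟩
    refine ⟨C ∪ C', hC.union hC', fun b hb => ?_⟩
    rcases hb with ⟨hb | hb, hb'⟩
    · obtain ⟨a, ha, e⟩ := h b ⟨hb, hb'⟩; exact ⟨a, Or.inl ha, e⟩
    · obtain ⟨a, ha, e⟩ := h' b ⟨hb, hb'⟩; exact ⟨a, Or.inr ha, e⟩
  · rintro _ ⟨-, ⟨p, rfl⟩⟩
    obtain ⟨N, hN, hNp⟩ := exists_compact_mem_nhds p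
    have hm : d '' N ∈ 𝓝[Set.range d] (d p) := h p (image_mem_map hNp)
    exact ⟨d '' N, nhdsWithin_mono _ Set.inter_subset_right hm, N, hN, fun b hb => hb.1⟩

/-- In terms of the quotient: the points of Y that lie in K + Z have relatively compact image in Y /
(Y ∩ Z). This is how compatibility yields compact supports on quotients. -/
theorem Compat.exists_compact_lift (h : Compat iY iZ) (hY : Continuous iY) (hZ : Continuous iZ)
    {K : Set G} (hK : IsCompact K) :
    ∃ C : Set Y, IsCompact C ∧ ∀ y z, iY y - iZ z ∈ K → ∃ c ∈ C, iY (y - c) ∈ iZ.range := by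
  obtain ⟨C, hC, hl⟩ := h.exists_compact_lift_prod hY hZ hK
  refine ⟨Prod.fst '' C, hC.image continuous_fst, fun y z hyz => ?_⟩
  obtain ⟨q, hq, e⟩ := hl y z hyz
  refine ⟨q.1, ⟨q, hq, rfl⟩, z - q.2, ?_⟩
  rw [sub_eq_sub_iff_add_eq_add] at e
  rw [map_sub, map_sub, sub_eq_sub_iff_add_eq_add, add_comm]
  exact e

/-- A function of `(y, z)` that depends only on `y - z` and has compact support as a function of
the difference comes from a continuous function with compact support on `G`. -/
theorem Compat.exists_extension (h : Compat iY iZ) (hY : Continuous iY) (hZ : Continuous iZ)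
    {K : Set G} (hK : IsCompact K) {u : Y → Z → ℂ} (hu : Continuous (Function.uncurry u))
    (hd : ∀ y z y' z', iY y - iZ z = iY y' - iZ z' → u y z = u y' z')
    (hs : ∀ y z, u y z ≠ 0 → iY y - iZ z ∈ K) :
    ∃ H : G → ℂ, Continuous H ∧ HasCompactSupport H ∧ ∀ y z, H (iY y - iZ z) = u y z := by
  classical
  set d : Y × Z → G := fun q => iY q.1 - iZ q.2 with hdd
  set φ : G → ℂ := Function.extend d (Function.uncurry u) 0 with hφ
  have hφd : ∀ p, φ (d p) = u p.1 p.2 := fun p =>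
    Function.FactorsThrough.extend_apply
      (fun p q hpq => hd p.1 p.2 q.1 q.2 hpq) _ p
  -- Openness onto the range makes the difference map a quotient map, so continuity of u descends to
  -- the topology induced by G.
  have φc : ContinuousOn φ (Set.range d) := by
    rintro _ ⟨p, rfl⟩
    refine Tendsto.mono_left ?_ (h p)
    rw [tendsto_map'_iff]
    change Tendsto (fun q => φ (d q)) (𝓝 p) (𝓝 (φ (d p)))
    simp only [hφd]
    exact hu.tendsto p
  have φs : ∀ r ∈ Set.range d, φ r ≠ 0 → r ∈ K := by
    rintro _ ⟨p, rfl⟩ hp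
    rw [hφd] at hp
    exact hs _ _ hp
  obtain ⟨χ, χc, χs, -, -, χ1⟩ := exists_cutoff hK
  set C : Set G := tsupport χ ∩ Set.range d with hC
  have hCc : IsCompact C := χs.isCompact.inter_right (h.isClosed_range hY hZ)
  have : CompactSpace C := isCompact_iff_compactSpace.1 hCc
  -- Tietze's theorem is applied in the one-point compactification, which is compact Hausdorff and
  -- hence normal. The factor χ then restores compact support without changing the values where φ is
  -- non-zero.
  let e : C → OnePoint G := fun c => ((c : G) : OnePoint G)
  have he : IsClosedEmbedding e :=
    (OnePoint.continuous_coe.comp continuous_subtype_val).isClosedEmbedding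
      (OnePoint.coe_injective.comp Subtype.val_injective)
  obtain ⟨F, hF⟩ := ContinuousMap.exists_extension' he
    (⟨fun c => φ c, (φc.mono Set.inter_subset_right).domRestrict⟩ : C(C, ℂ))
  refine ⟨fun g => χ g * F g, ?_, ?_, fun y z => ?_⟩
  · exact (Complex.continuous_ofReal.comp χc).mul (F.continuous.comp OnePoint.continuous_coe)
  · exact χs.mono fun g hg h => hg (by simp [h])
  · have hr : d (y, z) ∈ Set.range d := ⟨_, rfl⟩
    have e1 : u y z = φ (d (y, z)) := (hφd (y, z)).symm
    rw [e1]
    change (χ (d (y, z)) : ℂ) * F (d (y, z) : G) = φ (d (y, z))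
    by_cases ht : d (y, z) ∈ tsupport χ
    · have hFφ : F (d (y, z) : G) = φ (d (y, z)) := congrFun hF (⟨d (y, z), ht, hr⟩ : C)
      rw [hFφ]
      by_cases h0 : φ (d (y, z)) = 0
      · rw [h0, mul_zero]
      · rw [χ1 _ (φs _ hr h0)]; simp
    · have h0 : χ (d (y, z)) = 0 := image_eq_zero_of_notMem_tsupport ht
      rw [h0]
      by_contra hne
      have : φ (d (y, z)) ≠ 0 := fun h' => hne (by simp [h'])
      have := χ1 _ (φs _ hr this)
      rw [h0] at this
      exact zero_ne_one this

end Kernels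

/-! ### Closed linear spans of products of operators. -/

section ClMul

variable {H₁ H₂ H₃ H₄ : Type u} [NormedAddCommGroup H₁] [NormedSpace ℂ H₁]
    [NormedAddCommGroup H₂] [NormedSpace ℂ H₂] [NormedAddCommGroup H₃] [NormedSpace ℂ H₃]
    [NormedAddCommGroup H₄] [NormedSpace ℂ H₄]

theorem isClosed_clMul (𝓐 : Submodule ℂ (H₂ →L[ℂ] H₃)) (𝓑 : Submodule ℂ (H₁ →L[ℂ] H₂)) :
    IsClosed (𝓐 ⬝ᶜ 𝓑 : Set (H₁ →L[ℂ] H₃)) :=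
  Submodule.isClosed_topologicalClosure _

theorem comp_mem_clMul {𝓐 : Submodule ℂ (H₂ →L[ℂ] H₃)} {𝓑 : Submodule ℂ (H₁ →L[ℂ] H₂)}
    {A : H₂ →L[ℂ] H₃} {B : H₁ →L[ℂ] H₂} (hA : A ∈ 𝓐) (hB : B ∈ 𝓑) : A ∘L B ∈ 𝓐 ⬝ᶜ 𝓑 :=
  Submodule.le_topologicalClosure _ (Submodule.subset_span ⟨A, hA, B, hB, rfl⟩)

theorem closure_span_le {H : Type*} [NormedAddCommGroup H] [NormedSpace ℂ H] {s : Set H}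
    {𝓒 : Submodule ℂ H} (hC : IsClosed (𝓒 : Set H)) (h : ∀ x ∈ s, x ∈ 𝓒) :
    (Submodule.span ℂ s).topologicalClosure ≤ 𝓒 :=
  Submodule.topologicalClosure_minimal _ (Submodule.span_le.2 h) hC

theorem mem_closure_span {H : Type*} [NormedAddCommGroup H] [NormedSpace ℂ H] {s : Set H}
    {x : H} (h : x ∈ s) : x ∈ (Submodule.span ℂ s).topologicalClosure :=
  Submodule.le_topologicalClosure _ (Submodule.subset_span h)

/-- A continuous linear map sends a closed span into a closed subspace as soon as it does so for
the generators. -/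
theorem map_mem_of_closure_span {H H' : Type*} [NormedAddCommGroup H] [NormedSpace ℂ H]
    [NormedAddCommGroup H'] [NormedSpace ℂ H'] {s : Set H} (F : H →L[ℂ] H')
    {𝓒 : Submodule ℂ H'} (hC : IsClosed (𝓒 : Set H')) (h : ∀ x ∈ s, F x ∈ 𝓒) {x : H}
    (hx : x ∈ (Submodule.span ℂ s).topologicalClosure) : F x ∈ 𝓒 :=
  closure_span_le (𝓒 := 𝓒.comap (F : H →ₗ[ℂ] H')) (hC.preimage F.continuous) h hx

theorem clMul_le {𝓐 : Submodule ℂ (H₂ →L[ℂ] H₃)} {𝓑 : Submodule ℂ (H₁ →L[ℂ] H₂)}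
    {𝓒 : Submodule ℂ (H₁ →L[ℂ] H₃)} (hC : IsClosed (𝓒 : Set (H₁ →L[ℂ] H₃)))
    (h : ∀ A ∈ 𝓐, ∀ B ∈ 𝓑, A ∘L B ∈ 𝓒) : 𝓐 ⬝ᶜ 𝓑 ≤ 𝓒 :=
  closure_span_le hC (by rintro _ ⟨A, hA, B, hB, rfl⟩; exact h A hA B hB)

theorem closure_span_clMul_le {s : Set (H₂ →L[ℂ] H₃)} {t : Set (H₁ →L[ℂ] H₂)}
    {𝓒 : Submodule ℂ (H₁ →L[ℂ] H₃)} (hC : IsClosed (𝓒 : Set (H₁ →L[ℂ] H₃)))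
    (h : ∀ A ∈ s, ∀ B ∈ t, A ∘L B ∈ 𝓒) :
    (Submodule.span ℂ s).topologicalClosure ⬝ᶜ (Submodule.span ℂ t).topologicalClosure ≤ 𝓒 := by
  refine clMul_le hC fun A hA B hB => ?_
  refine map_mem_of_closure_span ((ContinuousLinearMap.compL ℂ H₁ H₂ H₃).flip B) hC
    (fun A hA => ?_) hA
  exact map_mem_of_closure_span (ContinuousLinearMap.compL ℂ H₁ H₂ H₃ A) hC
    (fun B hB => h A hA B hB) hB

theorem clMul_mono {𝓐 𝓐' : Submodule ℂ (H₂ →L[ℂ] H₃)} {𝓑 𝓑' : Submodule ℂ (H₁ →L[ℂ] H₂)}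
    (h : 𝓐 ≤ 𝓐') (h' : 𝓑 ≤ 𝓑') : 𝓐 ⬝ᶜ 𝓑 ≤ 𝓐' ⬝ᶜ 𝓑' :=
  clMul_le (isClosed_clMul _ _) fun _ hA _ hB => comp_mem_clMul (h hA) (h' hB)

theorem clMul_assoc (𝓐 : Submodule ℂ (H₃ →L[ℂ] H₄)) (𝓑 : Submodule ℂ (H₂ →L[ℂ] H₃))
    (𝓒 : Submodule ℂ (H₁ →L[ℂ] H₂)) : 𝓐 ⬝ᶜ 𝓑 ⬝ᶜ 𝓒 = 𝓐 ⬝ᶜ (𝓑 ⬝ᶜ 𝓒) := by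
  apply le_antisymm
  · refine clMul_le (isClosed_clMul _ _) fun S hS C hC => ?_
    refine map_mem_of_closure_span ((ContinuousLinearMap.compL ℂ H₁ H₂ H₄).flip C)
      (isClosed_clMul _ _) ?_ hS
    rintro _ ⟨A, hA, B, hB, rfl⟩
    exact comp_mem_clMul hA (comp_mem_clMul hB hC)
  · refine clMul_le (isClosed_clMul _ _) fun A hA S hS => ?_
    refine map_mem_of_closure_span (ContinuousLinearMap.compL ℂ H₁ H₃ H₄ A)
      (isClosed_clMul _ _) ?_ hS
    rintro _ ⟨B, hB, C, hC, rfl⟩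
    exact comp_mem_clMul (comp_mem_clMul hA hB) hC

/-- The fixed factor N absorbs the constants of Schur's test, so that the approximations can be
carried out with an unscaled ε. -/
theorem mem_of_forall_norm_sub_le {H : Type*} [NormedAddCommGroup H] [NormedSpace ℂ H]
    {𝓒 : Submodule ℂ H} (hC : IsClosed (𝓒 : Set H)) {x : H} (N : ℝ)
    (h : ∀ ε > 0, ∃ y ∈ 𝓒, ‖x - y‖ ≤ ε * N) : x ∈ 𝓒 := by
  have : x ∈ closure (𝓒 : Set H) := by
    rw [Metric.mem_closure_iff]
    intro ε hε
    obtain ⟨y, hy, hxy⟩ := h (ε / (|N| + 1)) (by positivity)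
    refine ⟨y, hy, ?_⟩
    rw [dist_eq_norm]
    refine (hxy.trans (mul_le_mul_of_nonneg_left (le_abs_self N) (by positivity))).trans_lt ?_
    rw [div_mul_eq_mul_div, div_lt_iff₀ (by positivity)]
    nlinarith [abs_nonneg N]
  rwa [hC.closure_eq] at this

theorem adjoint_mem_of_closure_span {H H' : Type*} [NormedAddCommGroup H] [InnerProductSpace ℂ H]
    [CompleteSpace H] [NormedAddCommGroup H'] [InnerProductSpace ℂ H'] [CompleteSpace H']
    {s : Set (H →L[ℂ] H')} {𝓒 : Submodule ℂ (H' →L[ℂ] H)} (hC : IsClosed (𝓒 : Set (H' →L[ℂ] H)))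
    (h : ∀ A ∈ s, ContinuousLinearMap.adjoint A ∈ 𝓒) {A : H →L[ℂ] H'}
    (hA : A ∈ (Submodule.span ℂ s).topologicalClosure) : ContinuousLinearMap.adjoint A ∈ 𝓒 := by
  let F : (H →L[ℂ] H') →ₛₗ[starRingEnd ℂ] (H' →L[ℂ] H) :=
    { toFun := ContinuousLinearMap.adjoint
      map_add' := map_add _
      map_smul' := fun a A => ContinuousLinearMap.adjoint.map_smulₛₗ a A }
  exact closure_span_le (𝓒 := 𝓒.comap F)
    (hC.preimage (ContinuousLinearMap.adjoint (𝕜 := ℂ) (E := H) (F := H')).continuous) h hA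

end ClMul

/-! ### Spaces of convolution and multiplication operators, and the two halves of the product
identity. -/

section Kernels

variable {G X Y Z : Type u}
  [AddCommGroup G] [TopologicalSpace G] [IsTopologicalAddGroup G] [LocallyCompactSpace G]
  [T2Space G]
  [AddCommGroup X] [TopologicalSpace X] [IsTopologicalAddGroup X] [LocallyCompactSpace X]
  [T2Space X] [MeasurableSpace X] [BorelSpace X]
  [AddCommGroup Y] [TopologicalSpace Y] [IsTopologicalAddGroup Y] [LocallyCompactSpace Y]
  [T2Space Y] [MeasurableSpace Y] [BorelSpace Y]
  [AddCommGroup Z] [TopologicalSpace Z] [IsTopologicalAddGroup Z] [LocallyCompactSpace Z]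
  [T2Space Z] [MeasurableSpace Z] [BorelSpace Z]
  {iX : X →+ G} {iY : Y →+ G} {iZ : Z →+ G}
  {μ : Measure X} {ν : Measure Y} {ρ : Measure Z}

/-- The closed span of the operators with kernel `Φ(x - y)`, `Φ ∈ C_c(G)`. -/
def convSpan (iX : X →+ G) (iY : Y →+ G) (μ : Measure X) (ν : Measure Y) :
    Submodule ℂ (Lp ℂ 2 ν →L[ℂ] Lp ℂ 2 μ) :=
  (Submodule.span ℂ {T | ∃ Φ : G → ℂ, Continuous Φ ∧ HasCompactSupport Φ ∧
    IsKernel μ ν (fun x y => Φ (iX x - iY y)) T}).topologicalClosure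

/-- The closed span of the operators of multiplication by functions in `C₀(Y / W)`. -/
def mulSpan (ν : Measure Y) (W : AddSubgroup Y) : Submodule ℂ (Lp ℂ 2 ν →L[ℂ] Lp ℂ 2 ν) :=
  (Submodule.span ℂ {M | ∃ φ : C₀(Y ⧸ W, ℂ),
    IsMul ν (fun y => φ (QuotientAddGroup.mk y)) M}).topologicalClosure

theorem continuous_convKernel (hX : Continuous iX) (hY : Continuous iY) {Φ : G → ℂ}
    (hΦ : Continuous Φ) : Continuous (Function.uncurry fun x y => Φ (iX x - iY y)) := by
  have : Continuous fun p : X × Y => Φ (iX p.1 - iY p.2) := by fun_prop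
  exact this

theorem exists_convOp [μ.IsAddHaarMeasure] [ν.IsAddHaarMeasure] [ν.Regular]
    (hX : IsClosedEmbedding iX) (hY : IsClosedEmbedding iY) {Φ : G → ℂ} (hΦ : Continuous Φ)
    (hΦ' : HasCompactSupport Φ) :
    ∃ T : Lp ℂ 2 ν →L[ℂ] Lp ℂ 2 μ, IsKernel μ ν (fun x y => Φ (iX x - iY y)) T := by
  obtain ⟨c, hc⟩ := hΦ'.exists_bound_of_continuous hΦ
  obtain ⟨T, hT, -⟩ := exists_isKernel (μ := μ) (ν := ν) hX hY hΦ'.isCompact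
    (continuous_convKernel hX.continuous hY.continuous hΦ)
    (fun x y h => subset_tsupport _ h) (fun x y => hc _)
  exact ⟨T, hT⟩

theorem adjoint_mem_convSpan [μ.IsAddHaarMeasure] [ν.IsAddHaarMeasure] [μ.Regular] [ν.Regular]
    (hX : IsClosedEmbedding iX) (hY : IsClosedEmbedding iY)
    {T : Lp ℂ 2 ν →L[ℂ] Lp ℂ 2 μ} (hT : T ∈ convSpan iX iY μ ν) :
    ContinuousLinearMap.adjoint T ∈ convSpan iY iX ν μ := by
  refine adjoint_mem_of_closure_span (Submodule.isClosed_topologicalClosure _) ?_ hT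
  rintro S ⟨Φ, Φc, Φs, hS⟩
  obtain ⟨c, hc⟩ := Φs.exists_bound_of_continuous Φc
  have := hS.adjoint hX hY Φs.isCompact (continuous_convKernel hX.continuous hY.continuous Φc)
    (fun x y h => subset_tsupport _ h) (fun x y => hc _)
  refine mem_closure_span ⟨fun g => starRingEnd ℂ (Φ (-g)), by fun_prop, ?_, ?_⟩
  · exact (Φs.comp_homeomorph (Homeomorph.neg G)).comp_left (map_zero _)
  · simpa only [neg_sub] using this

theorem adjoint_mem_mulSpan {W : AddSubgroup Y} {M : Lp ℂ 2 ν →L[ℂ] Lp ℂ 2 ν}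
    (hM : M ∈ mulSpan ν W) : ContinuousLinearMap.adjoint M ∈ mulSpan ν W := by
  refine adjoint_mem_of_closure_span (Submodule.isClosed_topologicalClosure _) ?_ hM
  rintro S ⟨φ, hS⟩
  refine mem_closure_span ⟨star φ, hS.adjoint
    ((φ.continuous.comp QuotientAddGroup.continuous_mk).aestronglyMeasurable) (c := ‖φ‖)
    (fun y => ?_) (norm_nonneg _)⟩
  exact φ.toBCF.norm_coe_le_norm _

/-- The kernel of a product of two convolutions is a function of x - y and of the class of y in Y /
W, with compact support in both. Freezing the class at finitely many points aᵢ and weighting with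
bumps χᵢ on the quotient approximates it uniformly. -/
theorem convSpan_clMul_le [μ.IsAddHaarMeasure] [ν.IsAddHaarMeasure] [ρ.IsAddHaarMeasure]
    [ν.Regular] [ρ.Regular] (hX : IsClosedEmbedding iX) (hY : IsClosedEmbedding iY)
    (hZ : IsClosedEmbedding iZ) (hc : Compat iY iZ) {W : AddSubgroup Y}
    (hW : ∀ y, y ∈ W ↔ iY y ∈ iZ.range) :
    convSpan iX iZ μ ρ ⬝ᶜ convSpan iZ iY ρ ν ≤ convSpan iX iY μ ν ⬝ᶜ mulSpan ν W := by
  have hWc : IsClosed (W : Set Y) := by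
    have : (W : Set Y) = iY ⁻¹' Set.range iZ := by
      ext y; exact hW y
    rw [this]
    exact hZ.isClosed_range.preimage hY.continuous
  refine closure_span_clMul_le (isClosed_clMul _ _) ?_
  rintro T ⟨Φ, Φc, Φs, hT⟩ T' ⟨Ψ, Ψc, Ψs, hT'⟩
  set L : Set G := tsupport Φ + tsupport Ψ with hL
  have hLc : IsCompact L := Φs.isCompact.add Ψs.isCompact
  -- The product kernel at (x, y) is θ(y, x - y). Letting the first variable range over G turns
  -- invariance under Z into a shift of the integration variable.
  set θ : G → G → ℂ := fun g s => ∫ z, Φ (s + g - iZ z) * Ψ (iZ z - g) ∂ρ with hθ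
  have θc : Continuous (Function.uncurry θ) := by
    refine continuous_integral_of_locally_compact_support
      (F := fun (p : G × G) z => Φ (p.2 + p.1 - iZ z) * Ψ (iZ z - p.1)) ?_ fun p => ?_
    · have := hZ.continuous
      have : Continuous fun q : (G × G) × Z =>
        Φ (q.1.2 + q.1.1 - iZ q.2) * Ψ (iZ q.2 - q.1.1) := by fun_prop
      exact this
    · obtain ⟨U, hUc, hU⟩ := exists_compact_mem_nhds p.1
      refine ⟨U ×ˢ Set.univ, prod_mem_nhds hU univ_mem, iZ ⁻¹' (tsupport Ψ + U),
        hZ.isCompact_preimage (Ψs.isCompact.add hUc), fun q hq z hz => ?_⟩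
      by_contra h
      exact hz ⟨_, subset_tsupport _ (right_ne_zero_of_mul h), q.1, hq.1, by simp⟩
  have θs : ∀ g s, θ g s ≠ 0 → s ∈ L ∧ ∃ z, iZ z - g ∈ tsupport Ψ := by
    intro g s h
    obtain ⟨z, hz⟩ : ∃ z, Φ (s + g - iZ z) * Ψ (iZ z - g) ≠ 0 := by
      by_contra! h'
      exact h (by simp [hθ, h'])
    have h1 := subset_tsupport _ (left_ne_zero_of_mul hz)
    have h2 := subset_tsupport _ (right_ne_zero_of_mul hz)
    exact ⟨⟨_, h1, _, h2, by simp⟩, z, h2⟩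
  have θinv : ∀ g w s, θ (g + iZ w) s = θ g s := by
    intro g w s
    have := integral_sub_right_eq_self (μ := ρ) (fun z => Φ (s + g - iZ z) * Ψ (iZ z - g)) w
    refine Eq.trans (integral_congr_ae (ae_of_all _ fun z => ?_)) this
    change Φ _ * Ψ _ = Φ _ * Ψ _
    congr 2 <;> rw [map_sub] <;> abel
  have θmk : ∀ y y' : Y, (QuotientAddGroup.mk y : Y ⧸ W) = QuotientAddGroup.mk y' →
      θ (iY y) = θ (iY y') := by
    intro y y' h
    obtain ⟨w, hw⟩ := (hW _).1 (QuotientAddGroup.eq.1 h)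
    funext s
    rw [← θinv (iY y) w s, hw, map_add, map_neg]
    congr 1; abel
  -- The choice of representative is harmless: regularity in q is always obtained through `θq_mk`
  -- from that of θ.
  let θq : Y ⧸ W → G → ℂ := fun q => θ (iY q.out)
  have θq_mk : ∀ y, θq (QuotientAddGroup.mk y) = θ (iY y) := fun y =>
    θmk _ _ (Quotient.out_eq _)
  -- If θ(y, ·) ≠ 0 then y - z ∈ -supp Ψ for some z ∈ Z, so the class of y lies in the compact image
  -- of C.
  obtain ⟨C, hCc, hC⟩ := hc.exists_compact_lift hY.continuous hZ.continuous Ψs.isCompact.neg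
  refine mem_of_forall_norm_sub_le (isClosed_clMul _ _) (schurConst iX iY μ ν L) fun ε hε => ?_
  set U : Y ⧸ W → Set (Y ⧸ W) := fun q => {q' | ∀ s, ‖θq q' s - θq q s‖ ≤ ε} with hU
  have hUn : ∀ q, U q ∈ 𝓝 q := by
    intro q
    obtain ⟨y, rfl⟩ := QuotientAddGroup.mk_surjective q
    obtain ⟨v, hv, hvs⟩ := hLc.mem_uniformity_of_prod (s := Set.univ) (q := iY y)
      θc.continuousOn (Set.mem_univ _) (Metric.dist_mem_uniformity hε)
    rw [nhdsWithin_univ] at hv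
    refine mem_of_superset (QuotientAddGroup.isOpenMap_coe.image_mem_nhds
      (hY.continuous.continuousAt.preimage_mem_nhds hv)) ?_
    rintro _ ⟨y', hy', rfl⟩ s
    rw [θq_mk, θq_mk]
    by_cases hs : s ∈ L
    · rw [← dist_eq_norm]; exact (hvs _ hy' s hs).le
    · have h1 : θ (iY y') s = 0 := by by_contra h; exact hs (θs _ _ h).1
      have h2 : θ (iY y) s = 0 := by by_contra h; exact hs (θs _ _ h).1
      rw [h1, h2, sub_zero, norm_zero]; exact hε.le
  obtain ⟨n, a, χ, -, χc, χs, χU, χ0, χ1, χK⟩ :=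
    exists_bumps (hCc.image (QuotientAddGroup.continuous_mk (N := W))) U fun q _ => hUn q
  have θac : ∀ i, Continuous (θq (a i)) := fun i =>
    θc.comp (by fun_prop : Continuous fun s => (iY (a i).out, s))
  have θas : ∀ i, HasCompactSupport (θq (a i)) := fun i =>
    HasCompactSupport.of_support_subset_isCompact hLc fun s hs => (θs _ _ hs).1
  choose S hS using fun i => exists_convOp (μ := μ) (ν := ν) hX hY (θac i) (θas i)
  let χ₀ : Fin n → C₀(Y ⧸ W, ℂ) := fun i =>
    ⟨⟨fun q => (χ i q : ℂ), Complex.continuous_ofReal.comp (χc i)⟩,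
      ((χs i).comp_left (g := ((↑) : ℝ → ℂ)) Complex.ofReal_zero).is_zero_at_infty⟩
  have χle : ∀ i q, χ i q ≤ 1 := fun i q =>
    (Finset.single_le_sum (fun j _ => χ0 j q) (Finset.mem_univ i)).trans (χ1 q)
  choose M hM using fun i => exists_isMul (μ := ν) (b := fun y => χ₀ i (QuotientAddGroup.mk y))
    (((χ₀ i).continuous.comp QuotientAddGroup.continuous_mk).aestronglyMeasurable) (c := 1)
    (fun y => by
      change ‖((χ i _ : ℝ) : ℂ)‖ ≤ 1
      rw [Complex.norm_real, Real.norm_eq_abs, abs_of_nonneg (χ0 i _)]; exact χle i _) zero_le_one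
  refine ⟨∑ i, S i ∘L M i, Submodule.sum_mem _ fun i _ => comp_mem_clMul
    (mem_closure_span ⟨_, θac i, θas i, hS i⟩) (mem_closure_span ⟨χ₀ i, (hM i).1⟩), ?_⟩
  obtain ⟨cΦ, hcΦ⟩ := Φs.exists_bound_of_continuous Φc
  obtain ⟨cΨ, hcΨ⟩ := Ψs.exists_bound_of_continuous Ψc
  have kΦ := continuous_convKernel hX.continuous hZ.continuous Φc
  have kΨ := continuous_convKernel hZ.continuous hY.continuous Ψc
  have sΦ : ∀ x z, Φ (iX x - iZ z) ≠ 0 → iX x - iZ z ∈ tsupport Φ := fun x z h =>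
    subset_tsupport _ h
  have sΨ : ∀ z y, Ψ (iZ z - iY y) ≠ 0 → iZ z - iY y ∈ tsupport Ψ := fun x z h =>
    subset_tsupport _ h
  have K1 := hT.comp hX hY hZ Φs.isCompact Ψs.isCompact kΦ kΨ sΦ sΨ (fun _ _ => hcΦ _)
    (fun _ _ => hcΨ _) hT'
  have k1c := continuous_compKernel (ρ := ρ) hX hZ Φs.isCompact kΦ kΨ sΦ
  have k2c : ∀ i, Continuous (Function.uncurry fun x y =>
      θq (a i) (iX x - iY y) * χ₀ i (QuotientAddGroup.mk y)) := fun i =>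
    (continuous_convKernel hX.continuous hY.continuous (θac i)).mul
      (((χ₀ i).continuous.comp QuotientAddGroup.continuous_mk).comp continuous_snd)
  have s2 : ∀ i x y, θq (a i) (iX x - iY y) * χ₀ i (QuotientAddGroup.mk y) ≠ 0 →
      iX x - iY y ∈ L := fun i x y h => (θs _ _ (left_ne_zero_of_mul h)).1
  have K2 := IsKernel.sum Finset.univ (fun i _ => (hS i).comp_isMul (hM i).1)
    fun i _ => memLp_slice (ν := ν) hY hLc (k2c i) (s2 i)
  have K := K1.sub K2 (memLp_slice hY hLc k1c (compKernel_mem sΦ sΨ))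
    fun x => memLp_finsetSum _ fun i _ => memLp_slice (ν := ν) hY hLc (k2c i) (s2 i) x
  have e1 : ∀ x y, ∫ z, Φ (iX x - iZ z) * Ψ (iZ z - iY y) ∂ρ
      = θq (QuotientAddGroup.mk y) (iX x - iY y) := by
    intro x y
    rw [θq_mk]
    simp only [hθ, sub_add_cancel]
  -- Since ∑ χᵢ = 1 wherever the product kernel is non-zero, the error is a χᵢ-weighted sum of
  -- differences θ_q - θ_{aᵢ}. Each difference is at most ε on the support of χᵢ.
  have e2 : ∀ x y, ∫ z, Φ (iX x - iZ z) * Ψ (iZ z - iY y) ∂ρ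
      - ∑ i, θq (a i) (iX x - iY y) * χ₀ i (QuotientAddGroup.mk y)
      = ∑ i, (χ i (QuotientAddGroup.mk y) : ℂ) * (θq (QuotientAddGroup.mk y) (iX x - iY y)
        - θq (a i) (iX x - iY y)) := by
    intro x y
    have : θq (QuotientAddGroup.mk y) (iX x - iY y) = (∑ i, (χ i (QuotientAddGroup.mk y) : ℂ))
        * θq (QuotientAddGroup.mk y) (iX x - iY y) := by
      by_cases h0 : θq (QuotientAddGroup.mk y) (iX x - iY y) = 0
      · rw [h0, mul_zero]
      · rw [θq_mk] at h0
        obtain ⟨z, hz⟩ := (θs _ _ h0).2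
        obtain ⟨c, hcC, hcW⟩ := hC y z (by simpa using hz)
        have : (QuotientAddGroup.mk y : Y ⧸ W) = QuotientAddGroup.mk c :=
          (QuotientAddGroup.eq.2 (by rw [neg_add_eq_sub]; exact (hW _).2 hcW)).symm
        have := χK (QuotientAddGroup.mk y) ⟨c, hcC, this.symm⟩
        rw [← Complex.ofReal_sum, this, Complex.ofReal_one, one_mul]
    conv_lhs => rw [e1, this]
    rw [Finset.sum_mul, ← Finset.sum_sub_distrib]
    refine Finset.sum_congr rfl fun i _ => ?_
    change _ - _ * ((χ i _ : ℝ) : ℂ) = _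
    ring
  refine K.norm_le hX hY hLc ?_ ?_ fun x y => ?_
  · exact k1c.sub (continuous_finsetSum _ fun i _ => k2c i)
  · intro x y h
    by_contra hs
    apply h
    have h1 : ∀ q, θq q (iX x - iY y) = 0 := fun q => by
      by_contra h'; exact hs (θs _ _ h').1
    rw [e1]
    simp [h1]
  · rw [e2]
    calc _ ≤ ∑ i, χ i (QuotientAddGroup.mk y) * ε := by
          refine norm_sum_le_of_le _ fun i _ => ?_
          rw [norm_mul, Complex.norm_real, Real.norm_eq_abs, abs_of_nonneg (χ0 i _)]
          by_cases h0 : χ i (QuotientAddGroup.mk y) = 0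
          · rw [h0, zero_mul, zero_mul]
          · exact mul_le_mul_of_nonneg_left (χU i _ h0 _) (χ0 i _)
      _ ≤ ε := by
          rw [← Finset.sum_mul]
          exact mul_le_of_le_one_left hε.le (χ1 _)

/-- Functions with compact support suffice to generate `mulSpan`. -/
theorem mulSpan_eq {W : AddSubgroup Y} (hW : IsClosed (W : Set Y)) :
    mulSpan ν W = (Submodule.span ℂ {M | ∃ u : Y ⧸ W → ℂ, Continuous u ∧ HasCompactSupport u ∧
      IsMul ν (fun y => u (QuotientAddGroup.mk y)) M}).topologicalClosure := by
  apply le_antisymm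
  · refine closure_span_le (Submodule.isClosed_topologicalClosure _) ?_
    rintro M ⟨φ, hM⟩
    refine mem_of_forall_norm_sub_le (Submodule.isClosed_topologicalClosure _) 1 fun ε hε => ?_
    rw [mul_one]
    have hK : ∃ K : Set (Y ⧸ W), IsCompact K ∧ ∀ q, q ∉ K → ‖φ q‖ < ε := by
      have := φ.zero_at_infty' (Metric.ball_mem_nhds (0 : ℂ) hε)
      obtain ⟨K, hK, h⟩ := mem_cocompact.1 this
      exact ⟨K, hK, fun q hq => by simpa using h hq⟩
    obtain ⟨K, hK, hKε⟩ := hK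
    obtain ⟨χ, χc, χs, χ0, χ1, χK⟩ := exists_cutoff hK
    set u : Y ⧸ W → ℂ := fun q => χ q * φ q with hu
    have uc : Continuous u := (Complex.continuous_ofReal.comp χc).mul φ.continuous
    have us : HasCompactSupport u := χs.mono fun q hq h => hq (by simp [hu, h])
    obtain ⟨c, hc⟩ := us.exists_bound_of_continuous uc
    obtain ⟨S, hS, -⟩ := exists_isMul (μ := ν) (b := fun y => u (QuotientAddGroup.mk y))
      ((uc.comp QuotientAddGroup.continuous_mk).aestronglyMeasurable) (fun y => hc _)
      ((norm_nonneg _).trans (hc 0))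
    refine ⟨S, mem_closure_span ⟨u, uc, us, hS⟩, (hM.sub hS).norm_le hε.le fun y => ?_⟩
    by_cases hy : (QuotientAddGroup.mk y : Y ⧸ W) ∈ K
    · simp [hu, χK _ hy, hε.le]
    · have : φ (QuotientAddGroup.mk y) - u (QuotientAddGroup.mk y)
          = ((1 - χ (QuotientAddGroup.mk y) : ℝ) : ℂ) * φ (QuotientAddGroup.mk y) := by
        simp only [hu]; push_cast; ring
      rw [this, norm_mul, Complex.norm_real, Real.norm_eq_abs,
        abs_of_nonneg (sub_nonneg.2 (χ1 _))]
      exact (mul_le_of_le_one_left (norm_nonneg _) (by linarith [χ0 (QuotientAddGroup.mk y)])).trans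
        (hKε _ hy).le
  · refine closure_span_le (Submodule.isClosed_topologicalClosure _) ?_
    rintro M ⟨u, uc, us, hM⟩
    exact mem_closure_span ⟨⟨⟨u, uc⟩, us.is_zero_at_infty⟩, hM⟩

/-- The point is that the product of the two functions has compact support modulo W ∩ W'. If y = c +
a = c' + b with c, c' in compact sets, a ∈ W and b ∈ W', then a - b = c' - c stays in a compact set.
Compatibility then confines a to a compact set modulo W ∩ W'. -/
theorem mulSpan_clMul_mulSpan_le {A B Y : Type u}
    [AddCommGroup A] [TopologicalSpace A] [IsTopologicalAddGroup A] [LocallyCompactSpace A]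
    [T2Space A] [MeasurableSpace A] [BorelSpace A]
    [AddCommGroup B] [TopologicalSpace B] [IsTopologicalAddGroup B] [LocallyCompactSpace B]
    [T2Space B] [MeasurableSpace B] [BorelSpace B]
    [AddCommGroup Y] [TopologicalSpace Y] [IsTopologicalAddGroup Y] [LocallyCompactSpace Y]
    [T2Space Y] [MeasurableSpace Y] [BorelSpace Y] {ν : Measure Y} {iA : A →+ Y} {iB : B →+ Y}
    (hA : IsClosedEmbedding iA) (hB : IsClosedEmbedding iB) (hc : Compat iA iB)
    {W W' W'' : AddSubgroup Y} (hWA : W = iA.range) (hWB : W' = iB.range) (hW : W'' = W ⊓ W') :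
    mulSpan ν W ⬝ᶜ mulSpan ν W' ≤ mulSpan ν W'' := by
  have c1 : IsClosed (W : Set Y) := by rw [hWA]; exact hA.isClosed_range
  have c2 : IsClosed (W' : Set Y) := by rw [hWB]; exact hB.isClosed_range
  have c3 : IsClosed (W'' : Set Y) := by rw [hW]; exact c1.inter c2
  rw [mulSpan_eq c1, mulSpan_eq c2, mulSpan_eq c3]
  refine closure_span_clMul_le (Submodule.isClosed_topologicalClosure _) ?_
  rintro M ⟨u, uc, us, hM⟩ M' ⟨u', uc', us', hM'⟩
  have l1 : W'' ≤ W := hW ▸ inf_le_left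
  have l2 : W'' ≤ W' := hW ▸ inf_le_right
  set p : Y ⧸ W'' → Y ⧸ W := fun q => QuotientAddGroup.map W'' W (AddMonoidHom.id Y) l1 q with hp
  set p' : Y ⧸ W'' → Y ⧸ W' := fun q => QuotientAddGroup.map W'' W' (AddMonoidHom.id Y) l2 q with hp'
  have pc : Continuous p := (QuotientAddGroup.isQuotientMap_mk W'').continuous_iff.2
    (QuotientAddGroup.continuous_mk (N := W))
  have pc' : Continuous p' := (QuotientAddGroup.isQuotientMap_mk W'').continuous_iff.2
    (QuotientAddGroup.continuous_mk (N := W'))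
  refine mem_closure_span ⟨fun q => u (p q) * u' (p' q), (uc.comp pc).mul (uc'.comp pc'), ?_,
    hM.comp hM'⟩
  obtain ⟨C, hC, hCu⟩ := exists_compact_lift_of_isOpenMap
    (QuotientAddGroup.isOpenMap_coe (N := W)) QuotientAddGroup.mk_surjective us.isCompact
  obtain ⟨C', hC', hCu'⟩ := exists_compact_lift_of_isOpenMap
    (QuotientAddGroup.isOpenMap_coe (N := W')) QuotientAddGroup.mk_surjective us'.isCompact
  obtain ⟨D, hD, hDl⟩ := hc.exists_compact_lift hA.continuous hB.continuous (isCompact_sub hC' hC)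
  refine HasCompactSupport.of_support_subset_isCompact
    ((hC.add (hD.image hA.continuous)).image (QuotientAddGroup.continuous_mk (N := W'')))
    fun q hq => ?_
  obtain ⟨y, rfl⟩ := QuotientAddGroup.mk_surjective q
  obtain ⟨c, hcC, hcy⟩ := hCu (QuotientAddGroup.mk y) (subset_tsupport _ (left_ne_zero_of_mul hq))
  obtain ⟨c', hcC', hcy'⟩ :=
    hCu' (QuotientAddGroup.mk y) (subset_tsupport _ (right_ne_zero_of_mul hq))
  have h1 := QuotientAddGroup.eq.1 hcy
  have h2 := QuotientAddGroup.eq.1 hcy'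
  rw [hWA] at h1
  rw [hWB] at h2
  obtain ⟨a, ha⟩ := h1
  obtain ⟨b, hb⟩ := h2
  obtain ⟨d, hdD, hd⟩ := hDl a b ⟨c', hcC', c, hcC, by simp only [ha, hb]; abel⟩
  refine ⟨c + iA d, ⟨c, hcC, iA d, ⟨d, hdD, rfl⟩, rfl⟩, QuotientAddGroup.eq.2 ?_⟩
  have e : -(c + iA d) + y = iA (a - d) := by rw [map_sub, ha]; abel
  rw [e, hW, hWA, hWB]
  exact ⟨⟨_, rfl⟩, hd⟩

/-- The operators of convolution by functions in `C_c(X)` have no common kernel. -/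
theorem eq_zero_of_convSpan_apply_eq_zero [μ.IsAddHaarMeasure] [μ.Regular] {w : Lp ℂ 2 μ}
    (h : ∀ T ∈ convSpan (AddMonoidHom.id X) (AddMonoidHom.id X) μ μ, T w = 0) : w = 0 := by
  have key : ∀ φ : X → ℂ, Continuous φ → HasCompactSupport φ → ∫ y, φ y * w y ∂μ = 0 := by
    intro φ φc φs
    -- Convolution by the reflection of φ has the value ∫ φ w at x = 0. The convolution is
    -- continuous in x, so its vanishing almost everywhere may be evaluated at that point.
    have φc' : Continuous fun x => φ (-x) := by fun_prop
    have φs' : HasCompactSupport fun x => φ (-x) := φs.comp_homeomorph (Homeomorph.neg X)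
    obtain ⟨T, hT⟩ := exists_convOp (μ := μ) (ν := μ) (iX := AddMonoidHom.id X)
      (iY := AddMonoidHom.id X) IsClosedEmbedding.id IsClosedEmbedding.id φc' φs'
    have h0 := hT w
    rw [h T (mem_closure_span ⟨_, φc', φs', hT⟩)] at h0
    have hc : Continuous fun x => ∫ y, φ (-(x - y)) * w y ∂μ := by
      have := φs'.continuous_convolution_right (ContinuousLinearMap.mul ℂ ℂ)
        ((Lp.memLp w).locallyIntegrable (by norm_num)) φc'
      refine this.congr fun x => integral_congr_ae (ae_of_all _ fun y => ?_)
      simp only [ContinuousLinearMap.mul_apply']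
      ring
    have h1 := (Continuous.ae_eq_iff_eq μ (continuous_const (y := (0 : ℂ))) hc).1
      ((Lp.coeFn_zero ℂ 2 μ).symm.trans h0)
    simpa using (congrFun h1 0).symm
  have : ∀ f : Lp ℂ 2 μ, inner ℂ f w = 0 := by
    refine Lp_induction_of_hasCompactSupport (isClosed_eq (by fun_prop) continuous_const)
      fun φ hφ φc φs => ?_
    rw [L2.inner_def, ← key (fun x => starRingEnd ℂ (φ x)) (by fun_prop)
      (φs.comp_left (map_zero _))]
    refine integral_congr_ae ?_
    filter_upwards [hφ.coeFn_toLp] with x hx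
    rw [hx, RCLike.inner_apply, mul_comm]
  exact inner_self_eq_zero.1 (this w)

theorem exists_nhds_norm_sub_le {Φ : G → ℂ} (hΦ : Continuous Φ) (hΦ' : HasCompactSupport Φ) {ε : ℝ}
    (hε : 0 < ε) : ∃ V ∈ 𝓝 (0 : G), ∀ a b, b - a ∈ V → ‖Φ a - Φ b‖ ≤ ε := by
  let _ := IsTopologicalAddGroup.rightUniformSpace G
  have := isUniformAddGroup_of_addCommGroup (G := G)
  have h := hΦ'.uniformContinuous_of_continuous hΦ (Metric.dist_mem_uniformity hε)
  rw [uniformity_eq_comap_nhds_zero G] at h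
  obtain ⟨V, hV, h⟩ := h
  refine ⟨V, hV, fun a b hab => ?_⟩
  have := @h (a, b) hab
  rw [← dist_eq_norm]
  exact le_of_lt this

/-- Every function in `C_c(Y / W)`, `W = Y ∩ Z`, is obtained by integrating over `Z` the
differences `y - z` of some function in `C_c(G)`. -/
theorem exists_integral_sub_eq [ρ.IsAddHaarMeasure] (hY : IsClosedEmbedding iY)
    (hZ : IsClosedEmbedding iZ) (hc : Compat iY iZ) {W : AddSubgroup Y}
    (hW : ∀ y, y ∈ W ↔ iY y ∈ iZ.range) {u : Y ⧸ W → ℂ} (uc : Continuous u)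
    (us : HasCompactSupport u) : ∃ H : G → ℂ, Continuous H ∧ HasCompactSupport H ∧
      ∀ y, ∫ z, H (iY y - iZ z) ∂ρ = u (QuotientAddGroup.mk y) := by
  obtain ⟨C, hC, hCu⟩ := exists_compact_lift_of_isOpenMap
    (QuotientAddGroup.isOpenMap_coe (N := W)) QuotientAddGroup.mk_surjective us.isCompact
  obtain ⟨η, ηc, ηs, η0, -, ηK⟩ := exists_cutoff (hC.image hY.continuous)
  have hYc := hY.continuous
  have hZc := hZ.continuous
  have mkc : Continuous (QuotientAddGroup.mk : Y → Y ⧸ W) := QuotientAddGroup.continuous_mk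
  -- The desired function is H(y - z) = η(y - z) u(y) / e(y). The normalizer e is invariant under Y
  -- ∩ Z and positive over the support of u, because η = 1 on a compact lift of that support.
  set e : Y → ℝ := fun y => ∫ z, η (iY y - iZ z) ∂ρ with he
  have ec : Continuous e := by
    have : Continuous fun y => ∫ z, ((η (iY y - iZ z) : ℝ) : ℂ) ∂ρ := by
      refine continuous_integral_of_locally_compact_support ?_ fun y => ?_
      · have : Continuous fun q : Y × Z => ((η (iY q.1 - iZ q.2) : ℝ) : ℂ) := by fun_prop
        exact this
      · obtain ⟨U, hUc, hU⟩ := exists_compact_mem_nhds y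
        refine ⟨U, hU, iZ ⁻¹' (iY '' U - tsupport η),
          hZ.isCompact_preimage (isCompact_sub (hUc.image hYc) ηs.isCompact), fun q hq z hz => ?_⟩
        by_contra h
        exact hz ⟨_, ⟨q, hq, rfl⟩, _, subset_tsupport _ (Complex.ofReal_ne_zero.1 h), by simp⟩
    simp only [integral_complex_ofReal] at this
    exact Complex.continuous_re.comp this
  have einv : ∀ y y' z, iY y' = iY y + iZ z → e y' = e y := by
    intro y y' w hw
    have := integral_sub_right_eq_self (μ := ρ) (fun z => η (iY y - iZ z)) w
    refine Eq.trans (integral_congr_ae (ae_of_all _ fun z => ?_)) this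
    change η _ = η _
    congr 1; rw [map_sub, hw]; abel
  have epos : ∀ y, (QuotientAddGroup.mk y : Y ⧸ W) ∈ tsupport u → 0 < e y := by
    intro y hy
    obtain ⟨c, hcC, hcy⟩ := hCu _ hy
    obtain ⟨w, hw⟩ := (hW _).1 (QuotientAddGroup.eq.1 hcy)
    rw [einv c y w (by rw [hw, map_add, map_neg]; abel)]
    refine Continuous.integral_pos_of_hasCompactSupport_nonneg_nonzero (x := 0) (by fun_prop)
      (hasCompactSupport_slice hZ ηs.isCompact (iY c) fun z hz => subset_tsupport _ hz)
      (fun z => η0 _) ?_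
    rw [map_zero, sub_zero, ηK _ ⟨c, hcC, rfl⟩]
    exact one_ne_zero
  set r : Y → ℂ := fun y => u (QuotientAddGroup.mk y) / e y with hr
  have rc : Continuous r := by
    rw [continuous_iff_continuousAt]
    intro y
    by_cases hy : (QuotientAddGroup.mk y : Y ⧸ W) ∈ tsupport u
    · exact (uc.comp mkc).continuousAt.div (Complex.continuous_ofReal.comp ec).continuousAt
        (Complex.ofReal_ne_zero.2 (epos y hy).ne')
    · have : r =ᶠ[𝓝 y] fun _ => 0 := by
        filter_upwards [mkc.continuousAt.preimage_mem_nhds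
          ((isClosed_tsupport u).isOpen_compl.mem_nhds hy)] with y' hy'
        simp [hr, image_eq_zero_of_notMem_tsupport hy']
      exact continuousAt_const.congr this.symm
  -- Two pairs with the same difference have first components that differ by an element of Y ∩ Z.
  -- Hence η(y - z) r(y) depends on y - z alone.
  obtain ⟨H, Hc, Hs, hH⟩ := hc.exists_extension hYc hZc ηs.isCompact
    (u := fun y z => η (iY y - iZ z) * r y) (by
      have : Continuous fun q : Y × Z => (η (iY q.1 - iZ q.2) : ℂ) * r q.1 := by fun_prop
      exact this) (fun y z y' z' h => by
        have h' : iY y' = iY y + iZ (z' - z) := by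
          rw [map_sub, ← add_sub_assoc, sub_eq_sub_iff_add_eq_add.1 h, add_sub_cancel_right]
        have h1 : (QuotientAddGroup.mk y : Y ⧸ W) = QuotientAddGroup.mk y' :=
          QuotientAddGroup.eq.2 ((hW _).2 ⟨z' - z, by rw [map_add, h', map_neg]; abel⟩)
        simp only [hr, h, h1, einv y y' _ h'])
    (fun y z h => subset_tsupport _ (Complex.ofReal_ne_zero.1 (left_ne_zero_of_mul h)))
  refine ⟨H, Hc, Hs, fun y => ?_⟩
  simp only [hH]
  rw [integral_mul_const, integral_complex_ofReal]
  change (e y : ℂ) * (u _ / e y) = _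
  by_cases hy : (QuotientAddGroup.mk y : Y ⧸ W) ∈ tsupport u
  · exact mul_div_cancel₀ _ (Complex.ofReal_ne_zero.2 (epos y hy).ne')
  · simp [image_eq_zero_of_notMem_tsupport hy]

/-- With u(y) = ∫ H(y - z) dz the kernel becomes ∫ Θ(x - y) H(y - z) dz. When y - z is close to a, x
- y = (x - z) - (y - z) is close to x - z - a. Uniform continuity of Θ and bumps in the variable y -
z therefore separate the integrand into a function of x - z times a function of z - y. -/
theorem convSpan_clMul_mulSpan_le [μ.IsAddHaarMeasure] [ν.IsAddHaarMeasure] [ρ.IsAddHaarMeasure]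
    [ν.Regular] [ρ.Regular] (hX : IsClosedEmbedding iX) (hY : IsClosedEmbedding iY)
    (hZ : IsClosedEmbedding iZ) (hc : Compat iY iZ) {W : AddSubgroup Y}
    (hW : ∀ y, y ∈ W ↔ iY y ∈ iZ.range) :
    convSpan iX iY μ ν ⬝ᶜ mulSpan ν W ≤ convSpan iX iZ μ ρ ⬝ᶜ convSpan iZ iY ρ ν := by
  have hWc : IsClosed (W : Set Y) := by
    have : (W : Set Y) = iY ⁻¹' Set.range iZ := by
      ext y; exact hW y
    rw [this]
    exact hZ.isClosed_range.preimage hY.continuous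
  have hXc := hX.continuous
  have hYc := hY.continuous
  have hZc := hZ.continuous
  have mkc : Continuous (QuotientAddGroup.mk : Y → Y ⧸ W) := QuotientAddGroup.continuous_mk
  rw [mulSpan_eq hWc]
  refine closure_span_clMul_le (isClosed_clMul _ _) ?_
  rintro T ⟨Θ, Θc, Θs, hT⟩ M ⟨u, uc, us, hM⟩
  obtain ⟨H, Hc, Hs, hH⟩ := exists_integral_sub_eq (ρ := ρ) hY hZ hc hW uc us
  obtain ⟨cH, hcH⟩ := Hs.exists_bound_of_continuous Hc
  have cH0 : 0 ≤ cH := (norm_nonneg _).trans (hcH 0)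
  set K := tsupport H with hK
  have Kc : IsCompact K := Hs.isCompact
  -- This set must not depend on ε. It contains the supports of all approximants, since x - y = (x -
  -- z - aᵢ) + aᵢ - (y - z) with aᵢ and y - z in K.
  set L : Set G := tsupport Θ ∪ (tsupport Θ + K - K) with hL
  have Lc : IsCompact L := Θs.isCompact.union (isCompact_sub (Θs.isCompact.add Kc) Kc)
  refine mem_of_forall_norm_sub_le (isClosed_clMul _ _)
    (cH * ρ.real (iZ ⁻¹' (K - K)) * schurConst iX iY μ ν L) fun ε hε => ?_
  obtain ⟨V, hV, hVΘ⟩ := exists_nhds_norm_sub_le Θc Θs hε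
  obtain ⟨n, a, χ, haK, χc, χs, χU, χ0, χ1, χK⟩ := exists_bumps Kc (fun g => {g' | g' - g ∈ V})
    fun g _ => (by fun_prop : Continuous fun g' => g' - g).continuousAt.preimage_mem_nhds
      (by simpa using hV)
  set Φ : Fin n → G → ℂ := fun i g => Θ (g - a i) with hΦ
  set Ψ : Fin n → G → ℂ := fun i g => H (-g) * χ i (-g) with hΨ
  have Φc : ∀ i, Continuous (Φ i) := fun i => by fun_prop
  have Φs : ∀ i, HasCompactSupport (Φ i) := fun i =>
    Θs.comp_homeomorph (Homeomorph.subRight (a i))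
  have Ψc : ∀ i, Continuous (Ψ i) := fun i => by
    have := χc i
    fun_prop
  have Ψs : ∀ i, HasCompactSupport (Ψ i) := fun i =>
    (Hs.comp_homeomorph (Homeomorph.neg G)).mul_right
  choose S hS using fun i => exists_convOp (μ := μ) (ν := ρ) hX hZ (Φc i) (Φs i)
  choose S' hS' using fun i => exists_convOp (μ := ρ) (ν := ν) hZ hY (Ψc i) (Ψs i)
  refine ⟨∑ i, S i ∘L S' i, Submodule.sum_mem _ fun i _ => comp_mem_clMul
    (mem_closure_span ⟨_, Φc i, Φs i, hS i⟩) (mem_closure_span ⟨_, Ψc i, Ψs i, hS' i⟩), ?_⟩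
  have sΦ : ∀ i x z, Φ i (iX x - iZ z) ≠ 0 → iX x - iZ z ∈ tsupport (Φ i) := fun i x z h =>
    subset_tsupport _ h
  have sΨ : ∀ i z y, Ψ i (iZ z - iY y) ≠ 0 → iZ z - iY y ∈ tsupport (Ψ i) := fun i x z h =>
    subset_tsupport _ h
  have kΦ := fun i => continuous_convKernel hXc hZc (Φc i)
  have kΨ := fun i => continuous_convKernel hZc hYc (Ψc i)
  have kc := fun i => continuous_compKernel (ρ := ρ) hX hZ (Φs i).isCompact (kΦ i) (kΨ i) (sΦ i)
  have kL := fun i => memLp_slice (ν := ν) hY ((Φs i).isCompact.add (Ψs i).isCompact) (kc i)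
    (compKernel_mem (sΦ i) (sΨ i))
  have K1 : ∀ i, IsKernel μ ν (fun x y => ∫ z, Φ i (iX x - iZ z) * Ψ i (iZ z - iY y) ∂ρ)
      (S i ∘L S' i) := fun i => by
    obtain ⟨c, hc⟩ := (Φs i).exists_bound_of_continuous (Φc i)
    obtain ⟨c', hc'⟩ := (Ψs i).exists_bound_of_continuous (Ψc i)
    exact (hS i).comp hX hY hZ (Φs i).isCompact (Ψs i).isCompact (kΦ i) (kΨ i) (sΦ i) (sΨ i)
      (fun _ _ => hc _) (fun _ _ => hc' _) (hS' i)
  have k0c : Continuous (Function.uncurry fun x y =>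
      Θ (iX x - iY y) * u (QuotientAddGroup.mk y)) :=
    (continuous_convKernel hXc hYc Θc).mul ((uc.comp mkc).comp continuous_snd)
  have K2 := (hT.comp_isMul hM).sub (IsKernel.sum Finset.univ (fun i _ => K1 i) fun i _ => kL i)
    (memLp_slice (ν := ν) hY Θs.isCompact k0c fun x y h =>
      subset_tsupport _ (left_ne_zero_of_mul h))
    fun x => memLp_finsetSum _ fun i _ => kL i x
  -- Inserting ∑ χᵢ(y - z) = 1 where H(y - z) ≠ 0 puts the error under one integral. Its integrand
  -- is at most ε · `cH`, and its support in z has differences in K - K.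
  have e1 : ∀ x y, Θ (iX x - iY y) * u (QuotientAddGroup.mk y)
      - ∑ i, ∫ z, Φ i (iX x - iZ z) * Ψ i (iZ z - iY y) ∂ρ
      = ∫ z, H (iY y - iZ z) * ∑ i, (χ i (iY y - iZ z) : ℂ) *
        (Θ (iX x - iY y) - Θ (iX x - iZ z - a i)) ∂ρ := by
    intro x y
    have i1 : Integrable (fun z => Θ (iX x - iY y) * H (iY y - iZ z)) ρ :=
      Integrable.const_mul ((by fun_prop : Continuous fun z => H (iY y - iZ z)
        ).integrable_of_hasCompactSupport (hasCompactSupport_slice hZ Kc (iY y) fun z hz =>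
          subset_tsupport _ hz)) _
    have i2 : ∀ i ∈ Finset.univ, Integrable (fun z => Φ i (iX x - iZ z) * Ψ i (iZ z - iY y)) ρ :=
      fun i _ => by
        have := Φc i
        have := Ψc i
        exact (by fun_prop : Continuous fun z => Φ i (iX x - iZ z) * Ψ i (iZ z - iY y)
          ).integrable_of_hasCompactSupport ((hasCompactSupport_slice hZ (Φs i).isCompact (iX x)
            fun z hz => sΦ i x z hz).mul_right)
    rw [← hH, ← integral_const_mul, ← integral_finsetSum _ i2,
      ← integral_sub i1 (integrable_finsetSum _ i2)]
    refine integral_congr_ae (ae_of_all _ fun z => ?_)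
    have : H (iY y - iZ z) = H (iY y - iZ z) * ∑ i, (χ i (iY y - iZ z) : ℂ) := by
      by_cases h0 : H (iY y - iZ z) = 0
      · rw [h0, zero_mul]
      · rw [← Complex.ofReal_sum, χK _ (subset_tsupport _ h0), Complex.ofReal_one, mul_one]
    simp only [hΦ, hΨ, neg_sub]
    conv_lhs => enter [1]; rw [this]
    rw [Finset.mul_sum, Finset.mul_sum, Finset.mul_sum, ← Finset.sum_sub_distrib]
    refine Finset.sum_congr rfl fun i _ => ?_
    ring
  refine (K2.norm_le hX hY Lc (c := ε * (cH * ρ.real (iZ ⁻¹' (K - K)))) ?_ ?_ fun x y => ?_).trans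
    (le_of_eq (by ring))
  · exact k0c.sub (continuous_finsetSum _ fun i _ => kc i)
  · intro x y h
    by_cases h0 : Θ (iX x - iY y) = 0
    · rw [h0, zero_mul, zero_sub, neg_ne_zero] at h
      obtain ⟨i, -, hi⟩ := Finset.exists_ne_zero_of_sum_ne_zero h
      obtain ⟨z, hz⟩ : ∃ z, Φ i (iX x - iZ z) * Ψ i (iZ z - iY y) ≠ 0 := by
        by_contra! h'
        exact hi (by simp [h'])
      have h1 : iX x - iZ z - a i ∈ tsupport Θ := subset_tsupport _ (left_ne_zero_of_mul hz)
      have h2 : -(iZ z - iY y) ∈ K :=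
        subset_tsupport _ (left_ne_zero_of_mul (right_ne_zero_of_mul hz))
      exact Or.inr ⟨_, ⟨_, h1, _, haK i, rfl⟩, _, h2, by simp⟩
    · exact Or.inl (subset_tsupport _ h0)
  · rw [e1]
    refine (norm_integral_le_integral_norm _).trans ?_
    refine (integral_le_of_support_sub hZ (isCompact_sub Kc Kc) (c := ε * cH)
      (fun _ => norm_nonneg _) (fun z => ?_) fun z z' h h' => ?_).trans (le_of_eq (by ring))
    · rw [norm_mul, mul_comm]
      refine mul_le_mul ?_ (hcH _) (norm_nonneg _) hε.le
      calc _ ≤ ∑ i, χ i (iY y - iZ z) * ε := by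
            refine norm_sum_le_of_le _ fun i _ => ?_
            rw [norm_mul, Complex.norm_real, Real.norm_eq_abs, abs_of_nonneg (χ0 i _)]
            by_cases h0 : χ i (iY y - iZ z) = 0
            · rw [h0, zero_mul, zero_mul]
            · refine mul_le_mul_of_nonneg_left (hVΘ _ _ ?_) (χ0 i _)
              have : iX x - iZ z - a i - (iX x - iY y) = iY y - iZ z - a i := by abel
              rw [this]
              exact χU i _ h0
        _ ≤ ε := by
            rw [← Finset.sum_mul]
            exact mul_le_of_le_one_left hε.le (χ1 _)
    · have h1 : iY y - iZ z ∈ K :=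
        subset_tsupport _ (left_ne_zero_of_mul (norm_ne_zero_iff.1 h))
      have h2 : iY y - iZ z' ∈ K :=
        subset_tsupport _ (left_ne_zero_of_mul (norm_ne_zero_iff.1 h'))
      exact ⟨_, h2, _, h1, by simp⟩

end Kernels

theorem adjoint_mem_clMul {H₁ H₂ H₃ : Type u} [NormedAddCommGroup H₁] [InnerProductSpace ℂ H₁]
    [CompleteSpace H₁] [NormedAddCommGroup H₂] [InnerProductSpace ℂ H₂] [CompleteSpace H₂]
    [NormedAddCommGroup H₃] [InnerProductSpace ℂ H₃] [CompleteSpace H₃]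
    {𝓐 : Submodule ℂ (H₂ →L[ℂ] H₃)} {𝓑 : Submodule ℂ (H₁ →L[ℂ] H₂)}
    {𝓐' : Submodule ℂ (H₃ →L[ℂ] H₂)} {𝓑' : Submodule ℂ (H₂ →L[ℂ] H₁)}
    (hA : ∀ A ∈ 𝓐, ContinuousLinearMap.adjoint A ∈ 𝓐')
    (hB : ∀ B ∈ 𝓑, ContinuousLinearMap.adjoint B ∈ 𝓑') {T : H₁ →L[ℂ] H₃} (hT : T ∈ 𝓐 ⬝ᶜ 𝓑) :
    ContinuousLinearMap.adjoint T ∈ 𝓑' ⬝ᶜ 𝓐' := by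
  refine adjoint_mem_of_closure_span (isClosed_clMul _ _) ?_ hT
  rintro _ ⟨A, hA', B, hB', rfl⟩
  rw [ContinuousLinearMap.adjoint_comp]
  exact comp_mem_clMul (hB _ hB') (hA _ hA')

/-! ### Passing to an ambient group in the family. -/

section Family

variable {E : Type u} [AddCommGroup E] {𝓕 : LCAFamily E}

theorem isClosedEmbedding_of_exists {X Z : 𝓕.groups} (h : (X : AddSubgroup E) ≤ Z)
    (ht : 𝓕.top X = (𝓕.top Z).induced (AddSubgroup.inclusion h))
    (hc : IsClosed ((X : AddSubgroup E).addSubgroupOf Z : Set (Z : AddSubgroup E))) :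
    IsClosedEmbedding (AddSubgroup.inclusion h) := by
  refine ⟨⟨⟨ht⟩, AddSubgroup.inclusion_injective h⟩, ?_⟩
  have := congrArg (fun H : AddSubgroup (Z : AddSubgroup E) => (H : Set (Z : AddSubgroup E)))
    (AddSubgroup.inclusion_range h)
  simp only [AddMonoidHom.coe_range] at this
  rw [this]
  exact hc

/-- The family supplies closed embeddings of X and G into some common Z. The map X → G inherits the
property because it becomes a closed embedding after composition with G → Z. -/
theorem isClosedEmbedding_inclusion {X G : 𝓕.groups} (h : (X : AddSubgroup E) ≤ G) :
    IsClosedEmbedding (AddSubgroup.inclusion h) := by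
  obtain ⟨Z, hX, hG, tX, tG, cX, cG, -⟩ := 𝓕.exists_compatible X G
  have eX := isClosedEmbedding_of_exists hX tX cX
  have eG := isClosedEmbedding_of_exists hG tG cG
  exact (IsClosedEmbedding.of_comp_iff (f := AddSubgroup.inclusion h) eG).1 eX

/-- Compatibility is given only inside some Z. A member containing both Z and G carries it over to
an arbitrary G. -/
theorem compat_inclusion {X Y G : 𝓕.groups} (hX : (X : AddSubgroup E) ≤ G)
    (hY : (Y : AddSubgroup E) ≤ G) :
    Compat (AddSubgroup.inclusion hX) (AddSubgroup.inclusion hY) := by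
  obtain ⟨Z, hXZ, hYZ, tX, tY, cX, cY, ho⟩ := 𝓕.exists_compatible X Y
  have key : Compat (AddSubgroup.inclusion hXZ) (AddSubgroup.inclusion hYZ) := by
    rintro ⟨x, y⟩
    set X' := (X : AddSubgroup E).addSubgroupOf Z
    set Y' := (Y : AddSubgroup E).addSubgroupOf Z
    set F : X' × Y' → ↥(X' ⊔ Y') := fun p =>
      ⟨(p.1 : (Z : AddSubgroup E)) + (p.2 : (Z : AddSubgroup E)),
        AddSubgroup.add_mem_sup p.1.2 p.2.2⟩ with hF
    set d : ↥(X : AddSubgroup E) × ↥(Y : AddSubgroup E) → (Z : AddSubgroup E) := fun q =>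
      AddSubgroup.inclusion hXZ q.1 - AddSubgroup.inclusion hYZ q.2 with hd
    -- The sign on the second component converts the addition map of `CompatibleSubgroups` into the
    -- difference map of `Compat`.
    let φ : X' × Y' → ↥(X : AddSubgroup E) × ↥(Y : AddSubgroup E) := fun p =>
      (⟨((p.1 : (Z : AddSubgroup E)) : E), p.1.2⟩, -⟨((p.2 : (Z : AddSubgroup E)) : E), p.2.2⟩)
    have φc : Continuous φ := by
      refine Continuous.prodMk ?_ (Continuous.neg ?_)
      · refine (isClosedEmbedding_of_exists hXZ tX cX).isInducing.continuous_iff.2 ?_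
        exact continuous_subtype_val.comp continuous_fst
      · refine (isClosedEmbedding_of_exists hYZ tY cY).isInducing.continuous_iff.2 ?_
        exact continuous_subtype_val.comp continuous_snd
    have hdφ : d ∘ φ = Subtype.val ∘ F := by
      funext p
      ext
      simp [hd, φ, hF]
    let p₀ : X' × Y' := (⟨AddSubgroup.inclusion hXZ x, x.2⟩, ⟨AddSubgroup.inclusion hYZ (-y), (-y).2⟩)
    have hp₀ : φ p₀ = (x, y) := by
      ext <;> simp [φ, p₀]
    have hdp : d (x, y) = (F p₀ : (Z : AddSubgroup E)) := by
      rw [← hp₀]; exact congrFun hdφ p₀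
    change 𝓝[Set.range d] (d (x, y)) ≤ map d (𝓝 (x, y))
    calc 𝓝[Set.range d] (d (x, y))
        ≤ 𝓝[((X' ⊔ Y' : AddSubgroup (Z : AddSubgroup E)) : Set (Z : AddSubgroup E))]
            (d (x, y)) := by
          refine nhdsWithin_mono _ ?_
          rintro _ ⟨q, rfl⟩
          exact sub_mem (AddSubgroup.mem_sup_left q.1.2) (AddSubgroup.mem_sup_right q.2.2)
      _ = map Subtype.val (𝓝 (F p₀)) := by
          rw [hdp]
          exact (map_nhds_subtype_val (F p₀)).symm
      _ ≤ map Subtype.val (map F (𝓝 p₀)) := Filter.map_mono (ho.nhds_le p₀)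
      _ = map d (map φ (𝓝 p₀)) := by rw [Filter.map_map, Filter.map_map, hdφ]
      _ ≤ map d (𝓝 (x, y)) := Filter.map_mono (by rw [← hp₀]; exact φc.tendsto p₀)
  obtain ⟨Z', hG, hZ, -⟩ := 𝓕.exists_compatible G Z
  have h1 := (Compat.comp_iff (isClosedEmbedding_inclusion hZ).isEmbedding).2 key
  exact (Compat.comp_iff (isClosedEmbedding_inclusion hG).isEmbedding).1 h1

theorem exists_common_group (X Y Z : 𝓕.groups) : ∃ G : 𝓕.groups, (X : AddSubgroup E) ≤ G ∧
    (Y : AddSubgroup E) ≤ G ∧ (Z : AddSubgroup E) ≤ G := by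
  obtain ⟨G₁, hX, hY, -⟩ := 𝓕.exists_compatible X Y
  obtain ⟨G, hG, hZ, -⟩ := 𝓕.exists_compatible G₁ Z
  exact ⟨G, hX.trans hG, hY.trans hG, hZ⟩

/-- Together with `isCc_of_hasCompactSupport`, this shows that C_c(X + Y) consists exactly of the
restrictions of C_c(G), so all convolutions can be taken with functions on one group G. -/
theorem IsCc.exists_extension {X Y G : 𝓕.groups} (hX : (X : AddSubgroup E) ≤ G)
    (hY : (Y : AddSubgroup E) ≤ G) {φ : ↥((X : AddSubgroup E) ⊔ (Y : AddSubgroup E)) → ℂ}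
    (hφ : IsCc X Y φ) : ∃ Φ : ↥(G : AddSubgroup E) → ℂ, Continuous Φ ∧ HasCompactSupport Φ ∧
      ∀ x y, Φ (AddSubgroup.inclusion hX x - AddSubgroup.inclusion hY y) = φ (diffMap X Y (x, y)) := by
  let _ := sumTopology X Y
  have eX := isClosedEmbedding_inclusion hX
  have eY := isClosedEmbedding_inclusion hY
  have eXc := eX.continuous
  have eYc := eY.continuous
  have jc : Continuous (AddSubgroup.inclusion (sup_le hX hY)) := by
    refine continuous_coinduced_dom.2 ?_
    have : Continuous fun p : ↥(X : AddSubgroup E) × ↥(Y : AddSubgroup E) =>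
      AddSubgroup.inclusion hX p.1 - AddSubgroup.inclusion hY p.2 := by fun_prop
    exact this
  have hs : HasCompactSupport φ := hφ.2
  refine (compat_inclusion hX hY).exists_extension eXc eYc (hs.isCompact.image jc)
    (u := fun x y => φ (diffMap X Y (x, y))) ?_ ?_ ?_
  · exact continuous_coinduced_dom.1 hφ.1
  · intro x y x' y' h
    refine congrArg φ (Subtype.ext ?_)
    exact congrArg (fun g : (G : AddSubgroup E) => (g : E)) h
  · intro x y h
    exact ⟨_, subset_tsupport _ h, rfl⟩

theorem isCc_of_hasCompactSupport {X Y G : 𝓕.groups} (hX : (X : AddSubgroup E) ≤ G)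
    (hY : (Y : AddSubgroup E) ≤ G) {Φ : ↥(G : AddSubgroup E) → ℂ} (hΦ : Continuous Φ)
    (hΦ' : HasCompactSupport Φ) :
    IsCc X Y fun s => Φ (AddSubgroup.inclusion (sup_le hX hY) s) := by
  let _ := sumTopology X Y
  have eX := isClosedEmbedding_inclusion hX
  have eY := isClosedEmbedding_inclusion hY
  have eXc := eX.continuous
  have eYc := eY.continuous
  have jc : Continuous (AddSubgroup.inclusion (sup_le hX hY)) := by
    refine continuous_coinduced_dom.2 ?_
    have : Continuous fun p : ↥(X : AddSubgroup E) × ↥(Y : AddSubgroup E) =>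
      AddSubgroup.inclusion hX p.1 - AddSubgroup.inclusion hY p.2 := by fun_prop
    exact this
  have dc : Continuous (diffMap X Y) := continuous_coinduced_rng
  -- With the sum topology Hausdorff, a compact set that contains the support is closed and so
  -- contains its closure.
  have : T2Space ↥((X : AddSubgroup E) ⊔ (Y : AddSubgroup E)) :=
    T2Space.of_injective_continuous (AddSubgroup.inclusion_injective (sup_le hX hY)) jc
  obtain ⟨C, hC, hl⟩ := (compat_inclusion hX hY).exists_compact_lift_prod eXc eYc hΦ'.isCompact
  refine ⟨hΦ.comp jc, HasCompactSupport.of_support_subset_isCompact (hC.image dc) fun s hs => ?_⟩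
  obtain ⟨x, hx, y, hy, hxy⟩ := AddSubgroup.mem_sup.1 s.2
  have h1 : AddSubgroup.inclusion (sup_le hX hY) s
      = AddSubgroup.inclusion hX ⟨x, hx⟩ - AddSubgroup.inclusion hY ⟨-y, neg_mem hy⟩ := by
    ext
    simp [← hxy]
  obtain ⟨q, hq, hqs⟩ := hl ⟨x, hx⟩ ⟨-y, neg_mem hy⟩ (by
    rw [← h1]; exact subset_tsupport _ hs)
  refine ⟨q, hq, AddSubgroup.inclusion_injective (sup_le hX hY) ?_⟩
  rw [h1, ← hqs]
  rfl

end Family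

/-! ### The product identity for the spaces 𝒯_XY and 𝒞_X(Y). -/

namespace ManyBodySystem

variable {E : Type u} [AddCommGroup E] {𝓕 : LCAFamily E} (𝓢 : ManyBodySystem 𝓕)

instance (X : 𝓢.S) : (𝓢.haar X).IsAddHaarMeasure := 𝓢.isAddHaarMeasure X
instance (X : 𝓢.S) : (𝓢.haar X).Regular := 𝓢.regular X

theorem TXY_eq_convSpan {X Y : 𝓢.S} {G : 𝓕.groups}
    (hX : ((X : 𝓕.groups) : AddSubgroup E) ≤ G) (hY : ((Y : 𝓕.groups) : AddSubgroup E) ≤ G) :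
    𝓢.TXY X Y = convSpan (AddSubgroup.inclusion hX) (AddSubgroup.inclusion hY)
      (𝓢.haar X) (𝓢.haar Y) := by
  unfold TXY convSpan
  congr 2
  ext T
  constructor
  · rintro ⟨φ, hφ, hT⟩
    obtain ⟨Φ, Φc, Φs, hΦ⟩ := hφ.exists_extension hX hY
    exact ⟨Φ, Φc, Φs, fun f => by simpa only [hΦ] using hT f⟩
  · rintro ⟨Φ, Φc, Φs, hT⟩
    exact ⟨_, isCc_of_hasCompactSupport hX hY Φc Φs, hT⟩

theorem exists_isConv (X Y : 𝓢.S)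
    (φ : ↥(((X : 𝓕.groups) : AddSubgroup E) ⊔ ((Y : 𝓕.groups) : AddSubgroup E)) → ℂ)
    (hφ : IsCc (X : 𝓕.groups) (Y : 𝓕.groups) φ) : ∃ T, 𝓢.IsConv X Y φ T := by
  obtain ⟨G, hX, hY, -⟩ := exists_common_group (X : 𝓕.groups) (Y : 𝓕.groups) (Y : 𝓕.groups)
  obtain ⟨Φ, Φc, Φs, hΦ⟩ := hφ.exists_extension hX hY
  obtain ⟨T, hT⟩ := exists_convOp (μ := 𝓢.haar X) (ν := 𝓢.haar Y) (isClosedEmbedding_inclusion hX)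
    (isClosedEmbedding_inclusion hY) Φc Φs
  exact ⟨T, fun f => by simpa only [hΦ] using hT f⟩

theorem adjoint_mem_TXY {X Y : 𝓢.S} {T : 𝓢.HX Y →L[ℂ] 𝓢.HX X} (hT : T ∈ 𝓢.TXY X Y) :
    ContinuousLinearMap.adjoint T ∈ 𝓢.TXY Y X := by
  obtain ⟨G, hX, hY, -⟩ := exists_common_group (X : 𝓕.groups) (Y : 𝓕.groups) (Y : 𝓕.groups)
  rw [𝓢.TXY_eq_convSpan hX hY] at hT
  rw [𝓢.TXY_eq_convSpan hY hX]
  exact adjoint_mem_convSpan (isClosedEmbedding_inclusion hX) (isClosedEmbedding_inclusion hY) hT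

/-- The closed subspace generated by `𝒞_X(Y)`. -/
def mulSub (X Y : 𝓢.S) : Submodule ℂ (𝓢.HX X →L[ℂ] 𝓢.HX X) :=
  mulSpan (𝓢.haar X) (((Y : 𝓕.groups) : AddSubgroup E).addSubgroupOf ((X : 𝓕.groups) : AddSubgroup E))

/-- The central identity; all the structure of 𝒞 is deduced from it, its adjoint and
`mulSub_clMul_mulSub_le`. -/
theorem TXY_clMul_TXY (X Y Z W : 𝓢.S) (hW : ((W : 𝓕.groups) : AddSubgroup E)
    = ((Y : 𝓕.groups) : AddSubgroup E) ⊓ ((Z : 𝓕.groups) : AddSubgroup E)) :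
    𝓢.TXY X Z ⬝ᶜ 𝓢.TXY Z Y = 𝓢.TXY X Y ⬝ᶜ 𝓢.mulSub Y W := by
  obtain ⟨G, hX, hY, hZ⟩ := exists_common_group (X : 𝓕.groups) (Y : 𝓕.groups) (Z : 𝓕.groups)
  rw [𝓢.TXY_eq_convSpan hX hZ, 𝓢.TXY_eq_convSpan hZ hY, 𝓢.TXY_eq_convSpan hX hY]
  have hm : ∀ y : ((Y : 𝓕.groups) : AddSubgroup E),
      y ∈ ((W : 𝓕.groups) : AddSubgroup E).addSubgroupOf ((Y : 𝓕.groups) : AddSubgroup E) ↔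
        AddSubgroup.inclusion hY y ∈ (AddSubgroup.inclusion hZ).range := by
    intro y
    rw [AddSubgroup.inclusion_range, AddSubgroup.mem_addSubgroupOf, AddSubgroup.mem_addSubgroupOf,
      hW]
    simp
  have eX := isClosedEmbedding_inclusion hX
  have eY := isClosedEmbedding_inclusion hY
  have eZ := isClosedEmbedding_inclusion hZ
  exact le_antisymm (convSpan_clMul_le eX eY eZ (compat_inclusion hY hZ) hm)
    (convSpan_clMul_mulSpan_le eX eY eZ (compat_inclusion hY hZ) hm)

theorem TXY_clMul_TXY' (X Y Z W : 𝓢.S) (hW : ((W : 𝓕.groups) : AddSubgroup E)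
    = ((X : 𝓕.groups) : AddSubgroup E) ⊓ ((Z : 𝓕.groups) : AddSubgroup E)) :
    𝓢.TXY X Z ⬝ᶜ 𝓢.TXY Z Y = 𝓢.mulSub X W ⬝ᶜ 𝓢.TXY X Y := by
  have h := 𝓢.TXY_clMul_TXY Y X Z W hW
  apply le_antisymm
  · intro T hT
    have h1 : ContinuousLinearMap.adjoint T ∈ 𝓢.TXY Y Z ⬝ᶜ 𝓢.TXY Z X :=
      adjoint_mem_clMul (fun _ => 𝓢.adjoint_mem_TXY) (fun _ => 𝓢.adjoint_mem_TXY) hT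
    rw [h] at h1
    rw [← ContinuousLinearMap.adjoint_adjoint T]
    exact adjoint_mem_clMul (fun _ => 𝓢.adjoint_mem_TXY) (fun _ => adjoint_mem_mulSpan) h1
  · intro T hT
    have h1 : ContinuousLinearMap.adjoint T ∈ 𝓢.TXY Y X ⬝ᶜ 𝓢.mulSub X W :=
      adjoint_mem_clMul (fun _ => adjoint_mem_mulSpan) (fun _ => 𝓢.adjoint_mem_TXY) hT
    rw [← h] at h1
    rw [← ContinuousLinearMap.adjoint_adjoint T]
    exact adjoint_mem_clMul (fun _ => 𝓢.adjoint_mem_TXY) (fun _ => 𝓢.adjoint_mem_TXY) h1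

theorem mulSub_clMul_mulSub_le {V W W' W'' : 𝓢.S}
    (hW : ((W : 𝓕.groups) : AddSubgroup E) ≤ (V : 𝓕.groups))
    (hW' : ((W' : 𝓕.groups) : AddSubgroup E) ≤ (V : 𝓕.groups))
    (h : ((W'' : 𝓕.groups) : AddSubgroup E)
      = ((W : 𝓕.groups) : AddSubgroup E) ⊓ ((W' : 𝓕.groups) : AddSubgroup E)) :
    𝓢.mulSub V W ⬝ᶜ 𝓢.mulSub V W' ≤ 𝓢.mulSub V W'' := by
  refine mulSpan_clMul_mulSpan_le (isClosedEmbedding_inclusion hW)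
    (isClosedEmbedding_inclusion hW') (compat_inclusion hW hW')
    (AddSubgroup.inclusion_range hW).symm (AddSubgroup.inclusion_range hW').symm ?_
  rw [h]
  rfl

theorem eq_zero_of_TXY_apply_eq_zero {X : 𝓢.S} {w : 𝓢.HX X}
    (h : ∀ T ∈ 𝓢.TXY X X, T w = 0) : w = 0 := by
  rw [𝓢.TXY_eq_convSpan (G := (X : 𝓕.groups)) le_rfl le_rfl] at h
  exact eq_zero_of_convSpan_apply_eq_zero h

end ManyBodySystem

/-! ### Block operators on ⊕ L²(X) and the algebra 𝒞. -/

namespace ManyBodySystem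

variable {E : Type u} [AddCommGroup E] {𝓕 : LCAFamily E} (𝓢 : ManyBodySystem 𝓕)

open Classical in
theorem adjoint_proj_apply (X : 𝓢.S) (v : 𝓢.HX X) :
    ContinuousLinearMap.adjoint (𝓢.proj X) v = lp.single 2 X v := by
  refine ext_inner_right ℂ fun w => ?_
  rw [ContinuousLinearMap.adjoint_inner_left, lp.inner_single_left]
  rfl

theorem proj_adjoint_proj (X : 𝓢.S) (v : 𝓢.HX X) :
    𝓢.proj X (ContinuousLinearMap.adjoint (𝓢.proj X) v) = v := by
  classical
  rw [adjoint_proj_apply]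
  exact lp.single_apply_self 2 X v

theorem proj_adjoint_proj_of_ne {X Y : 𝓢.S} (h : X ≠ Y) (v : 𝓢.HX Y) :
    𝓢.proj X (ContinuousLinearMap.adjoint (𝓢.proj Y) v) = 0 := by
  classical
  rw [adjoint_proj_apply]
  exact lp.single_apply_ne 2 Y v h

theorem embed_comp_embed {X Y Z : 𝓢.S} (A : 𝓢.HX Z →L[ℂ] 𝓢.HX X) (B : 𝓢.HX Y →L[ℂ] 𝓢.HX Z) :
    𝓢.embed A ∘L 𝓢.embed B = 𝓢.embed (A ∘L B) := by
  ext1 v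
  simp [embed, proj_adjoint_proj]

theorem embed_comp_embed_of_ne {X Y Z Z' : 𝓢.S} (h : Z ≠ Z') (A : 𝓢.HX Z →L[ℂ] 𝓢.HX X)
    (B : 𝓢.HX Y →L[ℂ] 𝓢.HX Z') : 𝓢.embed A ∘L 𝓢.embed B = 0 := by
  ext1 v
  simp [embed, 𝓢.proj_adjoint_proj_of_ne h]

theorem adjoint_embed {X Y : 𝓢.S} (A : 𝓢.HX Y →L[ℂ] 𝓢.HX X) :
    ContinuousLinearMap.adjoint (𝓢.embed A) = 𝓢.embed (ContinuousLinearMap.adjoint A) := by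
  simp only [embed, ContinuousLinearMap.adjoint_comp, ContinuousLinearMap.adjoint_adjoint]
  rfl

/-- `embed` as a continuous linear map. -/
def embedL (X Y : 𝓢.S) : (𝓢.HX Y →L[ℂ] 𝓢.HX X) →L[ℂ] (𝓢.H →L[ℂ] 𝓢.H) :=
  (ContinuousLinearMap.compL ℂ 𝓢.H (𝓢.HX X) 𝓢.H (ContinuousLinearMap.adjoint (𝓢.proj X))) ∘L
    ((ContinuousLinearMap.compL ℂ 𝓢.H (𝓢.HX Y) (𝓢.HX X)).flip (𝓢.proj Y))

variable {𝓢}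

theorem embed_mem_blockSpace {R : ∀ X Y : 𝓢.S, Submodule ℂ (𝓢.HX Y →L[ℂ] 𝓢.HX X)} {X Y : 𝓢.S}
    {T : 𝓢.HX Y →L[ℂ] 𝓢.HX X} (hT : T ∈ R X Y) : 𝓢.embed T ∈ 𝓢.blockSpace R :=
  mem_closure_span ⟨X, Y, T, hT, rfl⟩

theorem embed_mem_diagSpace {R : ∀ X : 𝓢.S, Submodule ℂ (𝓢.HX X →L[ℂ] 𝓢.HX X)} {X : 𝓢.S}
    {T : 𝓢.HX X →L[ℂ] 𝓢.HX X} (hT : T ∈ R X) : 𝓢.embed T ∈ 𝓢.diagSpace R :=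
  mem_closure_span ⟨X, T, hT, rfl⟩

/-- The condition is phrased with pulled-back subspaces, which are again closed, so that `CXY_le`
and `clMul_le` apply to each block directly. -/
theorem blockSpace_le {R : ∀ X Y : 𝓢.S, Submodule ℂ (𝓢.HX Y →L[ℂ] 𝓢.HX X)}
    {𝓒 : Submodule ℂ (𝓢.H →L[ℂ] 𝓢.H)} (hC : IsClosed (𝓒 : Set (𝓢.H →L[ℂ] 𝓢.H)))
    (h : ∀ X Y, R X Y ≤ 𝓒.comap (𝓢.embedL X Y).toLinearMap) : 𝓢.blockSpace R ≤ 𝓒 :=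
  closure_span_le hC (by rintro _ ⟨X, Y, T, hT, rfl⟩; exact h X Y hT)

theorem blockSpace_mono {R R' : ∀ X Y : 𝓢.S, Submodule ℂ (𝓢.HX Y →L[ℂ] 𝓢.HX X)}
    (h : ∀ X Y, R X Y ≤ R' X Y) : 𝓢.blockSpace R ≤ 𝓢.blockSpace R' :=
  blockSpace_le (Submodule.isClosed_topologicalClosure _)
    fun X Y _ hT => embed_mem_blockSpace (h X Y hT)

theorem blockSpace_clMul_le {R R' : ∀ X Y : 𝓢.S, Submodule ℂ (𝓢.HX Y →L[ℂ] 𝓢.HX X)}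
    {𝓒 : Submodule ℂ (𝓢.H →L[ℂ] 𝓢.H)} (hC : IsClosed (𝓒 : Set (𝓢.H →L[ℂ] 𝓢.H)))
    (h : ∀ X Y Z, ∀ A ∈ R X Z, ∀ B ∈ R' Z Y, 𝓢.embed (A ∘L B) ∈ 𝓒) :
    𝓢.blockSpace R ⬝ᶜ 𝓢.blockSpace R' ≤ 𝓒 := by
  refine closure_span_clMul_le hC ?_
  rintro _ ⟨X, Z, A, hA, rfl⟩ _ ⟨Z', Y, B, hB, rfl⟩
  by_cases hZ : Z = Z'
  · subst hZ
    rw [embed_comp_embed]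
    exact h X Y Z A hA B hB
  · rw [embed_comp_embed_of_ne _ hZ]
    exact 𝓒.zero_mem

theorem blockSpace_clMul_diagSpace_le {R : ∀ X Y : 𝓢.S, Submodule ℂ (𝓢.HX Y →L[ℂ] 𝓢.HX X)}
    {R' : ∀ X : 𝓢.S, Submodule ℂ (𝓢.HX X →L[ℂ] 𝓢.HX X)} :
    𝓢.blockSpace R ⬝ᶜ 𝓢.diagSpace R' ≤ 𝓢.blockSpace fun X Y => R X Y ⬝ᶜ R' Y := by
  refine closure_span_clMul_le (Submodule.isClosed_topologicalClosure _) ?_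
  rintro _ ⟨X, Z, A, hA, rfl⟩ _ ⟨Z', B, hB, rfl⟩
  by_cases hZ : Z = Z'
  · subst hZ
    rw [embed_comp_embed]
    exact embed_mem_blockSpace (R := fun X Y => R X Y ⬝ᶜ R' Y) (comp_mem_clMul hA hB)
  · rw [embed_comp_embed_of_ne _ hZ]
    exact Submodule.zero_mem _

theorem diagSpace_clMul_blockSpace_le {R : ∀ X Y : 𝓢.S, Submodule ℂ (𝓢.HX Y →L[ℂ] 𝓢.HX X)}
    {R' : ∀ X : 𝓢.S, Submodule ℂ (𝓢.HX X →L[ℂ] 𝓢.HX X)} :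
    𝓢.diagSpace R' ⬝ᶜ 𝓢.blockSpace R ≤ 𝓢.blockSpace fun X Y => R' X ⬝ᶜ R X Y := by
  refine closure_span_clMul_le (Submodule.isClosed_topologicalClosure _) ?_
  rintro _ ⟨Z, A, hA, rfl⟩ _ ⟨Z', Y, B, hB, rfl⟩
  by_cases hZ : Z = Z'
  · subst hZ
    rw [embed_comp_embed]
    exact embed_mem_blockSpace (R := fun X Y => R' X ⬝ᶜ R X Y) (comp_mem_clMul hA hB)
  · rw [embed_comp_embed_of_ne _ hZ]
    exact Submodule.zero_mem _

theorem exists_inf (X Y : 𝓢.S) : ∃ W : 𝓢.S, ((W : 𝓕.groups) : AddSubgroup E)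
    = ((X : 𝓕.groups) : AddSubgroup E) ⊓ ((Y : 𝓕.groups) : AddSubgroup E) := by
  obtain ⟨Z, hZ, h⟩ := 𝓢.inf_mem X X.2 Y Y.2
  exact ⟨⟨Z, hZ⟩, h⟩

theorem mulSub_le_CX {X W : 𝓢.S} (h : ((W : 𝓕.groups) : AddSubgroup E) ≤ (X : 𝓕.groups)) :
    𝓢.mulSub X W ≤ 𝓢.CX X :=
  closure_span_le (Submodule.isClosed_topologicalClosure _)
    fun _ hM => mem_closure_span ⟨W, h, hM⟩

theorem TXY_clMul_mulSub {X Y W : 𝓢.S}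
    (h : ((W : 𝓕.groups) : AddSubgroup E) ≤ (Y : 𝓕.groups)) :
    𝓢.TXY X Y ⬝ᶜ 𝓢.mulSub Y W = 𝓢.TXY X W ⬝ᶜ 𝓢.TXY W Y :=
  (𝓢.TXY_clMul_TXY X Y W W (inf_eq_right.2 h).symm).symm

theorem mulSub_clMul_TXY {X Y W : 𝓢.S}
    (h : ((W : 𝓕.groups) : AddSubgroup E) ≤ (X : 𝓕.groups)) :
    𝓢.mulSub X W ⬝ᶜ 𝓢.TXY X Y = 𝓢.TXY X W ⬝ᶜ 𝓢.TXY W Y :=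
  (𝓢.TXY_clMul_TXY' X Y W W (inf_eq_right.2 h).symm).symm

theorem clMul_le_CXY (X Y Z : 𝓢.S) : 𝓢.TXY X Z ⬝ᶜ 𝓢.TXY Z Y ≤ 𝓢.CXY X Y := by
  obtain ⟨W, hW⟩ := exists_inf Y Z
  rw [𝓢.TXY_clMul_TXY X Y Z W hW]
  exact clMul_mono le_rfl (mulSub_le_CX (hW ▸ inf_le_left))

theorem clMul_le_CX_clMul (X Y Z : 𝓢.S) : 𝓢.TXY X Z ⬝ᶜ 𝓢.TXY Z Y ≤ 𝓢.CX X ⬝ᶜ 𝓢.TXY X Y := by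
  obtain ⟨W, hW⟩ := exists_inf X Z
  rw [𝓢.TXY_clMul_TXY' X Y Z W hW]
  exact clMul_mono (mulSub_le_CX (hW ▸ inf_le_left)) le_rfl

/-- With `clMul_le_CXY` this characterizes 𝒞_XY as the closed span of the 𝒯_XZ · 𝒯_ZY over all Z ∈
𝓢: a generator from 𝒞_Y(W) turns 𝒯_XY into 𝒯_XW · 𝒯_WY. The description treats X and Y alike, which
is why `CXY_eq` holds. -/
theorem CXY_le {X Y : 𝓢.S} {𝓒 : Submodule ℂ (𝓢.HX Y →L[ℂ] 𝓢.HX X)}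
    (hC : IsClosed (𝓒 : Set (𝓢.HX Y →L[ℂ] 𝓢.HX X)))
    (h : ∀ Z, 𝓢.TXY X Z ⬝ᶜ 𝓢.TXY Z Y ≤ 𝓒) : 𝓢.CXY X Y ≤ 𝓒 := by
  refine clMul_le hC fun A hA M hM => ?_
  refine map_mem_of_closure_span (ContinuousLinearMap.compL ℂ _ _ _ A) hC ?_ hM
  rintro M ⟨W, hW, hM⟩
  have : A ∘L M ∈ 𝓢.TXY X Y ⬝ᶜ 𝓢.mulSub Y W := comp_mem_clMul hA (mem_closure_span hM)
  rw [TXY_clMul_mulSub hW] at this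
  exact h W this

theorem CX_clMul_TXY_le {X Y : 𝓢.S} {𝓒 : Submodule ℂ (𝓢.HX Y →L[ℂ] 𝓢.HX X)}
    (hC : IsClosed (𝓒 : Set (𝓢.HX Y →L[ℂ] 𝓢.HX X)))
    (h : ∀ Z, 𝓢.TXY X Z ⬝ᶜ 𝓢.TXY Z Y ≤ 𝓒) : 𝓢.CX X ⬝ᶜ 𝓢.TXY X Y ≤ 𝓒 := by
  refine clMul_le hC fun M hM A hA => ?_
  refine map_mem_of_closure_span ((ContinuousLinearMap.compL ℂ _ _ _).flip A) hC ?_ hM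
  rintro M ⟨W, hW, hM⟩
  have : M ∘L A ∈ 𝓢.mulSub X W ⬝ᶜ 𝓢.TXY X Y := comp_mem_clMul (mem_closure_span hM) hA
  rw [mulSub_clMul_TXY hW] at this
  exact h W this

theorem CXY_eq (X Y : 𝓢.S) : 𝓢.CXY X Y = 𝓢.CX X ⬝ᶜ 𝓢.TXY X Y :=
  le_antisymm (CXY_le (isClosed_clMul _ _) fun Z => clMul_le_CX_clMul X Y Z)
    (CX_clMul_TXY_le (isClosed_clMul _ _) fun Z => clMul_le_CXY X Y Z)

/-- The intermediate Z is first cut down to Y ∩ Z with multipliers on the right, then to X ∩ Y ∩ Z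
with multipliers on the left. The resulting factors link comparable spaces only, so they belong to
𝒯°. -/
theorem TXY_clMul_TXY_eq_of_inf (X Y Z : 𝓢.S) : ∃ W : 𝓢.S,
    ((W : 𝓕.groups) : AddSubgroup E) ≤ (X : 𝓕.groups) ∧
    ((W : 𝓕.groups) : AddSubgroup E) ≤ (Y : 𝓕.groups) ∧
    𝓢.TXY X Z ⬝ᶜ 𝓢.TXY Z Y = 𝓢.TXY X W ⬝ᶜ 𝓢.TXY W Y := by
  obtain ⟨V, hV⟩ := exists_inf Y Z
  obtain ⟨W, hW⟩ := exists_inf X V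
  have hVY : ((V : 𝓕.groups) : AddSubgroup E) ≤ (Y : 𝓕.groups) := hV ▸ inf_le_left
  have hWX : ((W : 𝓕.groups) : AddSubgroup E) ≤ (X : 𝓕.groups) := hW ▸ inf_le_left
  have hWV : ((W : 𝓕.groups) : AddSubgroup E) ≤ (V : 𝓕.groups) := hW ▸ inf_le_right
  refine ⟨W, hWX, hWV.trans hVY, ?_⟩
  rw [𝓢.TXY_clMul_TXY X Y Z V hV, TXY_clMul_mulSub hVY, 𝓢.TXY_clMul_TXY' X Y V W hW,
    mulSub_clMul_TXY hWX]

/-- The identity converts the path X, U, Z, V, Y into multipliers placed at V, which merge into one.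
That single multiplier becomes a visit to c = U ∩ V ∩ Z, and repeating the procedure at Y leaves one
multiplier in 𝒞_Y. -/
theorem TXY_clMul_four_le (X U Z V Y : 𝓢.S) :
    (𝓢.TXY X U ⬝ᶜ 𝓢.TXY U Z) ⬝ᶜ (𝓢.TXY Z V ⬝ᶜ 𝓢.TXY V Y) ≤ 𝓢.CXY X Y := by
  obtain ⟨a, ha⟩ := exists_inf V Z
  obtain ⟨b, hb⟩ := exists_inf V U
  obtain ⟨c, hc⟩ := exists_inf b a
  obtain ⟨d, hd⟩ := exists_inf Y V
  obtain ⟨e, he⟩ := exists_inf Y c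
  obtain ⟨f, hf⟩ := exists_inf e d
  have haV : ((a : 𝓕.groups) : AddSubgroup E) ≤ (V : 𝓕.groups) := ha ▸ inf_le_left
  have hbV : ((b : 𝓕.groups) : AddSubgroup E) ≤ (V : 𝓕.groups) := hb ▸ inf_le_left
  have hcV : ((c : 𝓕.groups) : AddSubgroup E) ≤ (V : 𝓕.groups) :=
    (hc ▸ inf_le_left : ((c : 𝓕.groups) : AddSubgroup E) ≤ (b : 𝓕.groups)).trans hbV
  have hdY : ((d : 𝓕.groups) : AddSubgroup E) ≤ (Y : 𝓕.groups) := hd ▸ inf_le_left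
  have heY : ((e : 𝓕.groups) : AddSubgroup E) ≤ (Y : 𝓕.groups) := he ▸ inf_le_left
  have hfY : ((f : 𝓕.groups) : AddSubgroup E) ≤ (Y : 𝓕.groups) :=
    (hf ▸ inf_le_left : ((f : 𝓕.groups) : AddSubgroup E) ≤ (e : 𝓕.groups)).trans heY
  calc (𝓢.TXY X U ⬝ᶜ 𝓢.TXY U Z) ⬝ᶜ (𝓢.TXY Z V ⬝ᶜ 𝓢.TXY V Y)
      = 𝓢.TXY X U ⬝ᶜ (𝓢.TXY U Z ⬝ᶜ 𝓢.TXY Z V) ⬝ᶜ 𝓢.TXY V Y := by simp only [clMul_assoc]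
    _ = (𝓢.TXY X U ⬝ᶜ 𝓢.TXY U V) ⬝ᶜ 𝓢.mulSub V a ⬝ᶜ 𝓢.TXY V Y := by
        rw [𝓢.TXY_clMul_TXY U V Z a ha]; simp only [clMul_assoc]
    _ = 𝓢.TXY X V ⬝ᶜ (𝓢.mulSub V b ⬝ᶜ 𝓢.mulSub V a) ⬝ᶜ 𝓢.TXY V Y := by
        rw [𝓢.TXY_clMul_TXY X V U b hb]; simp only [clMul_assoc]
    _ ≤ 𝓢.TXY X V ⬝ᶜ 𝓢.mulSub V c ⬝ᶜ 𝓢.TXY V Y :=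
        clMul_mono (clMul_mono le_rfl (𝓢.mulSub_clMul_mulSub_le hbV haV hc)) le_rfl
    _ = 𝓢.TXY X c ⬝ᶜ (𝓢.TXY c V ⬝ᶜ 𝓢.TXY V Y) := by
        rw [TXY_clMul_mulSub hcV, clMul_assoc]
    _ = (𝓢.TXY X c ⬝ᶜ 𝓢.TXY c Y) ⬝ᶜ 𝓢.mulSub Y d := by
        rw [𝓢.TXY_clMul_TXY c Y V d hd, clMul_assoc]
    _ = 𝓢.TXY X Y ⬝ᶜ (𝓢.mulSub Y e ⬝ᶜ 𝓢.mulSub Y d) := by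
        rw [𝓢.TXY_clMul_TXY X Y c e he, clMul_assoc]
    _ ≤ 𝓢.TXY X Y ⬝ᶜ 𝓢.CX Y :=
        clMul_mono le_rfl ((𝓢.mulSub_clMul_mulSub_le heY hdY hf).trans (mulSub_le_CX hfY))

theorem CXY_clMul_CXY_le (X Z Y : 𝓢.S) : 𝓢.CXY X Z ⬝ᶜ 𝓢.CXY Z Y ≤ 𝓢.CXY X Y := by
  have hcl : IsClosed (𝓢.CXY X Y : Set (𝓢.HX Y →L[ℂ] 𝓢.HX X)) := isClosed_clMul _ _
  refine clMul_le hcl fun A hA B hB => ?_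
  let F := (ContinuousLinearMap.compL ℂ (𝓢.HX Y) (𝓢.HX Z) (𝓢.HX X)).flip B
  refine CXY_le (𝓒 := (𝓢.CXY X Y).comap F.toLinearMap) (hcl.preimage F.continuous)
    (fun U S hS => ?_) hA
  let F' := ContinuousLinearMap.compL ℂ (𝓢.HX Y) (𝓢.HX Z) (𝓢.HX X) S
  exact CXY_le (𝓒 := (𝓢.CXY X Y).comap F'.toLinearMap) (hcl.preimage F'.continuous)
    (fun V S' hS' => TXY_clMul_four_le X U Z V Y (comp_mem_clMul hS hS')) hB

variable (𝓢)

theorem C_eq_T_clMul_T : 𝓢.C = 𝓢.T ⬝ᶜ 𝓢.T := by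
  apply le_antisymm
  · refine blockSpace_le (isClosed_clMul _ _) fun X Y => ?_
    have hcl := (isClosed_clMul 𝓢.T 𝓢.T).preimage (𝓢.embedL X Y).continuous
    refine CXY_le hcl fun Z => clMul_le hcl fun A hA B hB => ?_
    change 𝓢.embed (A ∘L B) ∈ 𝓢.T ⬝ᶜ 𝓢.T
    rw [← embed_comp_embed]
    exact comp_mem_clMul (embed_mem_blockSpace hA) (embed_mem_blockSpace hB)
  · exact blockSpace_clMul_le (Submodule.isClosed_topologicalClosure _) fun X Y Z A hA B hB =>
      embed_mem_blockSpace (clMul_le_CXY X Y Z (comp_mem_clMul hA hB))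

theorem C_eq_T_clMul_Cdiag : 𝓢.C = 𝓢.T ⬝ᶜ 𝓢.Cdiag := by
  apply le_antisymm
  · refine blockSpace_le (isClosed_clMul _ _) fun X Y => ?_
    have hcl := (isClosed_clMul 𝓢.T 𝓢.Cdiag).preimage (𝓢.embedL X Y).continuous
    refine clMul_le hcl fun A hA B hB => ?_
    change 𝓢.embed (A ∘L B) ∈ 𝓢.T ⬝ᶜ 𝓢.Cdiag
    rw [← embed_comp_embed]
    exact comp_mem_clMul (embed_mem_blockSpace hA) (embed_mem_diagSpace hB)
  · exact blockSpace_clMul_diagSpace_le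

theorem C_eq_Cdiag_clMul_T : 𝓢.C = 𝓢.Cdiag ⬝ᶜ 𝓢.T := by
  apply le_antisymm
  · refine blockSpace_le (isClosed_clMul _ _) fun X Y => ?_
    have hcl := (isClosed_clMul 𝓢.Cdiag 𝓢.T).preimage (𝓢.embedL X Y).continuous
    rw [CXY_eq]
    refine clMul_le hcl fun A hA B hB => ?_
    change 𝓢.embed (A ∘L B) ∈ 𝓢.Cdiag ⬝ᶜ 𝓢.T
    rw [← embed_comp_embed]
    exact comp_mem_clMul (embed_mem_diagSpace hA) (embed_mem_blockSpace hB)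
  · exact diagSpace_clMul_blockSpace_le.trans (blockSpace_mono fun X Y => (CXY_eq X Y).ge)

theorem embed_mem_Tcirc {X Y : 𝓢.S} {A : 𝓢.HX Y →L[ℂ] 𝓢.HX X} (hA : A ∈ 𝓢.TXY X Y)
    (h : ((X : 𝓕.groups) : AddSubgroup E) ≤ (Y : 𝓕.groups) ∨
      ((Y : 𝓕.groups) : AddSubgroup E) ≤ (X : 𝓕.groups)) : 𝓢.embed A ∈ 𝓢.Tcirc :=
  embed_mem_blockSpace (by rwa [if_pos h])

theorem Tcirc_le_T : 𝓢.Tcirc ≤ 𝓢.T := by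
  refine blockSpace_mono fun X Y => ?_
  split_ifs
  exacts [le_rfl, bot_le]

theorem C_eq_Tcirc_clMul_Tcirc : 𝓢.C = 𝓢.Tcirc ⬝ᶜ 𝓢.Tcirc := by
  apply le_antisymm
  · refine blockSpace_le (isClosed_clMul _ _) fun X Y => ?_
    have hcl := (isClosed_clMul 𝓢.Tcirc 𝓢.Tcirc).preimage (𝓢.embedL X Y).continuous
    refine CXY_le hcl fun Z => ?_
    obtain ⟨W, hWX, hWY, h⟩ := TXY_clMul_TXY_eq_of_inf X Y Z
    rw [h]
    refine clMul_le hcl fun A hA B hB => ?_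
    change 𝓢.embed (A ∘L B) ∈ 𝓢.Tcirc ⬝ᶜ 𝓢.Tcirc
    rw [← embed_comp_embed]
    exact comp_mem_clMul (𝓢.embed_mem_Tcirc hA (Or.inr hWX)) (𝓢.embed_mem_Tcirc hB (Or.inl hWY))
  · rw [C_eq_T_clMul_T]
    exact clMul_mono 𝓢.Tcirc_le_T 𝓢.Tcirc_le_T

theorem adjoint_mem_T {A : 𝓢.H →L[ℂ] 𝓢.H} (hA : A ∈ 𝓢.T) :
    ContinuousLinearMap.adjoint A ∈ 𝓢.T := by
  refine adjoint_mem_of_closure_span (Submodule.isClosed_topologicalClosure _) ?_ hA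
  rintro _ ⟨X, Y, S, hS, rfl⟩
  rw [adjoint_embed]
  exact embed_mem_blockSpace (𝓢.adjoint_mem_TXY hS)

theorem adjoint_mem_T_clMul_T {A : 𝓢.H →L[ℂ] 𝓢.H} (hA : A ∈ 𝓢.T ⬝ᶜ 𝓢.T) :
    ContinuousLinearMap.adjoint A ∈ 𝓢.T ⬝ᶜ 𝓢.T :=
  adjoint_mem_clMul (fun _ => 𝓢.adjoint_mem_T) (fun _ => 𝓢.adjoint_mem_T) hA

theorem C_clMul_C_le : 𝓢.C ⬝ᶜ 𝓢.C ≤ 𝓢.C :=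
  blockSpace_clMul_le (Submodule.isClosed_topologicalClosure _) fun X Y Z _ hA _ hB =>
    embed_mem_blockSpace (CXY_clMul_CXY_le X Z Y (comp_mem_clMul hA hB))

/-- The Hamiltonian algebra as a star subalgebra of the bounded operators. -/
def starSubalgebraTT : NonUnitalStarSubalgebra ℂ (𝓢.H →L[ℂ] 𝓢.H) :=
  { 𝓢.T ⬝ᶜ 𝓢.T with
    mul_mem' := fun {A B} hA hB => by
      change A ∘L B ∈ 𝓢.T ⬝ᶜ 𝓢.T
      rw [← C_eq_T_clMul_T]
      refine 𝓢.C_clMul_C_le (comp_mem_clMul ?_ ?_)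
      · rw [C_eq_T_clMul_T]; exact hA
      · rw [C_eq_T_clMul_T]; exact hB
    star_mem' := fun {A} hA => 𝓢.adjoint_mem_T_clMul_T hA }

theorem closure_span_range_T_clMul_T : (Submodule.span ℂ {v : 𝓢.H |
    ∃ A ∈ 𝓢.T ⬝ᶜ 𝓢.T, ∃ u : 𝓢.H, v = A u}).topologicalClosure = ⊤ := by
  rw [Submodule.topologicalClosure_eq_top_iff, Submodule.eq_bot_iff]
  intro v hv
  -- A vector orthogonal to all ranges is killed by all adjoints, and the algebra is self-adjoint.
  have h1 : ∀ A ∈ 𝓢.T ⬝ᶜ 𝓢.T, A v = 0 := by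
    intro A hA
    refine ext_inner_left ℂ fun u => ?_
    rw [inner_zero_right, ← ContinuousLinearMap.adjoint_inner_left]
    exact (Submodule.mem_orthogonal _ _).1 hv _
      (Submodule.subset_span ⟨_, 𝓢.adjoint_mem_T_clMul_T hA, u, rfl⟩)
  ext1
  funext X
  change 𝓢.proj X v = 0
  -- The faithfulness of convolutions on L²(X) is used twice, once for each factor of the diagonal
  -- block 𝒯_XX · 𝒯_XX.
  refine 𝓢.eq_zero_of_TXY_apply_eq_zero fun B hB => 𝓢.eq_zero_of_TXY_apply_eq_zero fun A hA => ?_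
  have h2 := h1 _ (comp_mem_clMul (embed_mem_blockSpace hA) (embed_mem_blockSpace hB))
  rw [embed_comp_embed] at h2
  have h3 := congrArg (𝓢.proj X) h2
  rw [map_zero] at h3
  rw [← h3]
  exact (𝓢.proj_adjoint_proj X _).symm

end ManyBodySystem

end ManyBody

end

theorem mainTheorem4 {E : Type*} [AddCommGroup E] {𝓕 : ManyBody.LCAFamily E}
    (𝓢 : ManyBody.ManyBodySystem 𝓕) :
    -- every `φ ∈ C_c(X + Y)` defines a bounded operator `T_{XY}(φ)`
    (∀ (X Y : 𝓢.S) (φ : ↥((X : AddSubgroup E) ⊔ (Y : AddSubgroup E)) → ℂ),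
      ManyBody.IsCc (X : 𝓕.groups) (Y : 𝓕.groups) φ → ∃ T, 𝓢.IsConv X Y φ T) ∧
    -- `𝒯` is a closed self-adjoint subspace of `𝓛`
    (𝓢.T ≤ 𝓢.bigL ∧ IsClosed (𝓢.T : Set (𝓢.H →L[ℂ] 𝓢.H)) ∧
      ∀ A ∈ 𝓢.T, ContinuousLinearMap.adjoint A ∈ 𝓢.T) ∧
    -- `𝒯 · 𝒯` is a C*-algebra of operators
    (∃ 𝓐 : NonUnitalStarSubalgebra ℂ (𝓢.H →L[ℂ] 𝓢.H),
      IsClosed (𝓐 : Set (𝓢.H →L[ℂ] 𝓢.H)) ∧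
      (𝓐 : Set (𝓢.H →L[ℂ] 𝓢.H)) = (ManyBody.clMul 𝓢.T 𝓢.T : Set (𝓢.H →L[ℂ] 𝓢.H))) ∧
    -- it is non-degenerate
    (Submodule.span ℂ {v : 𝓢.H |
      ∃ A ∈ ManyBody.clMul 𝓢.T 𝓢.T, ∃ u : 𝓢.H, v = A u}).topologicalClosure = ⊤ ∧
    -- the two expressions of the coupling modules `𝒞_{XY}` agree
    (∀ X Y : 𝓢.S, 𝓢.CXY X Y = ManyBody.clMul (𝓢.CX X) (𝓢.TXY X Y)) ∧
    -- the factorizations of `𝒞`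
    𝓢.C = ManyBody.clMul 𝓢.T 𝓢.T ∧
    𝓢.C = ManyBody.clMul 𝓢.T 𝓢.Cdiag ∧
    𝓢.C = ManyBody.clMul 𝓢.Cdiag 𝓢.T ∧
    𝓢.C = ManyBody.clMul 𝓢.Tcirc 𝓢.Tcirc := by
  refine ⟨𝓢.exists_isConv, ⟨?_, ?_, fun A => 𝓢.adjoint_mem_T⟩, ⟨𝓢.starSubalgebraTT, ?_, rfl⟩,
    𝓢.closure_span_range_T_clMul_T, ManyBody.ManyBodySystem.CXY_eq, 𝓢.C_eq_T_clMul_T,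
    𝓢.C_eq_T_clMul_Cdiag, 𝓢.C_eq_Cdiag_clMul_T, 𝓢.C_eq_Tcirc_clMul_Tcirc⟩
  · exact ManyBody.ManyBodySystem.blockSpace_mono fun _ _ => le_top
  · exact Submodule.isClosed_topologicalClosure _
  · exact ManyBody.isClosed_clMul _ _
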